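/- Let $(G_k)_{k\ge 0}$ be finite groups of order at least $2$, let $G=\prod_{k\ge0}G_k$ be their compact product and $\mu$ its normalized Haar measure (the product of the uniform measures). Let $p_k$ be the number of conjugacy classes of $G_k$, and put $P_0=1$, $P_{k+1}=p_kP_k$. Every $n\in\mathbb N$ has a unique expansion $n=\sum_{k\ge0}n_kP_k$ with $0\le n_k\le p_k-1$; for $n\geq 1$ put $|n|=\max\{k:n_k\ne0\}$, and put $n^{(s)}=\sum_{k\ge s}n_kP_k$. For each $k$ let $r_k^0=1,r_k^1,\dots,r_k^{p_k-1}$ be an enumeration of the irreducible complex characters of $G_k$, and let $\chi_n(x)=\prod_{k\ge0}r_k^{n_k}(x_k)$ for $x=(x_k)_k\in G$. For $y\in G$ let $$J_s(y)=\{x\in G:\ x_i \text{ is conjugate to } y_i \text{ in } G_i \text{ for all } 0\le i\le s-1\}.$$ Let $\mathcal M$ be a von Neumann algebra with a normal semifinite faithful trace $\tau$, let $\mathcal N=L_\infty(G,\mu)\,\bar\otimes\,\mathcal M$ with the tensor trace, and identify $L_p(\mathcal N)=L_p(G;L_p(\mathcal M))$ for $p=2,4$. For a family $(x_i)_{i\in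 I}$ in $L_2(\mathcal N)$ let $$\Big\|{\sup_{i\in I}}^{+}x_i\Big\|_2=\|(x_i)_i\|_{L_2(\mathcal N;\ell_\infty(I))}=\inf\Big\{\sup_i\|y_i\|_\infty\,\|a\|_4\|b\|_4:\ x_i=ay_ib\ \ (i\in I),\ a,b\in L_4(\mathcal N),\ (y_i)_i\subset\mathcal N\text{ bounded}\Big\},$$ with $\inf\emptyset=\infty$. Let $A,s\in\mathbb N$ with $A\ge s$, and let $f\in L_2(\mathcal N)$ (in particular, $f$ may be any element of $L_2(\mathcal N)$ that is constant on conjugacy classes). Then, for every $n$ with $|n|=A$, the function $$T_nf(y)=\frac1{\mu(J_s(y))}\int_{J_s(y)}f(x)\,\chi_{n^{(s)}}(y)\,\overline{\chi_{n^{(s)}}(x)}\,d\mu(x)\qquad(y\in G)$$ belongs to $L_2(\mathcal N)$, and $$\Big\|{\sup_{|n|=A}}^{+}T_nf\Big\|_2\le\|f\|_2 .$$ -/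

import Mathlib

open MeasureTheory Filter Topology
open scoped ENNReal NNReal ComplexConjugate

/-! ### Semifinite von Neumann algebras and their noncommutative `L_2`, `L_4` spaces -/

section Trace

variable {H : Type*} [NormedAddCommGroup H] [InnerProductSpace ℂ H] [CompleteSpace H]

/-- A normal semifinite faithful trace on the von Neumann algebra `M`.  It is a function
`M₊ → [0, ∞]`; the values of `toFun` outside the positive cone of `M` are junk and never used. -/
structure NSFTrace (M : VonNeumannAlgebra H) where
  toFun : (H →L[ℂ] H) → ℝ≥0∞
  map_add : ∀ x ∈ M, ∀ y ∈ M, 0 ≤ x → 0 ≤ y → toFun (x + y) = toFun x + toFun y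
  map_smul : ∀ (c : ℝ≥0), ∀ x ∈ M, 0 ≤ x → toFun (((c : ℝ) : ℂ) • x) = c * toFun x
  tracial : ∀ x ∈ M, toFun (star x * x) = toFun (x * star x)
  faithful : ∀ x ∈ M, 0 ≤ x → toFun x = 0 → x = 0
  normal : ∀ D : Set (H →L[ℂ] H), D.Nonempty → DirectedOn (· ≤ ·) D →
    (∀ d ∈ D, d ∈ M ∧ 0 ≤ d) → ∀ x ∈ M, IsLUB D x → toFun x = ⨆ d ∈ D, toFun d
  semifinite : ∀ x ∈ M, 0 ≤ x → x ≠ 0 →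
    ∃ y ∈ M, 0 ≤ y ∧ y ≤ x ∧ y ≠ 0 ∧ toFun y < ∞

namespace NSFTrace

variable {M : VonNeumannAlgebra H} (τ : NSFTrace M)

theorem smul_mem' {x : H →L[ℂ] H} (hx : x ∈ M) (c : ℂ) : c • x ∈ M :=
  M.toStarSubalgebra.smul_mem hx c

theorem star_mul_mem {x : H →L[ℂ] H} (hx : x ∈ M) : star x * x ∈ M :=
  mul_mem (star_mem hx) hx

theorem ofReal_smul_nonneg {x : H →L[ℂ] H} (hx : 0 ≤ x) (c : ℝ≥0) : 0 ≤ ((c : ℝ) : ℂ) • x := by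
  have h := star_left_conjugate_nonneg hx (((Real.sqrt c : ℝ) : ℂ) • (1 : H →L[ℂ] H))
  have e : star (((Real.sqrt c : ℝ) : ℂ) • (1 : H →L[ℂ] H)) * x *
      (((Real.sqrt c : ℝ) : ℂ) • (1 : H →L[ℂ] H)) = ((c : ℝ) : ℂ) • x := by
    rw [star_smul, star_one, smul_mul_assoc, smul_mul_assoc, mul_smul_comm, smul_smul, one_mul,
      mul_one]
    congr 1
    simp only [RCLike.star_def, Complex.conj_ofReal]
    rw [← Complex.ofReal_mul]
    exact congrArg _ (Real.mul_self_sqrt c.2)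
  rwa [e] at h

theorem mono {x y : H →L[ℂ] H} (hx : x ∈ M) (hy : y ∈ M) (h0 : 0 ≤ x) (h : x ≤ y) :
    τ.toFun x ≤ τ.toFun y := by
  have e := τ.map_add x hx (y - x) (sub_mem hy hx) h0 (sub_nonneg.2 h)
  rw [add_sub_cancel] at e
  rw [e]
  exact le_self_add

theorem sqrt_mem {b : H →L[ℂ] H} (hb : b ∈ M) : CFC.sqrt b ∈ M := by
  have h : CFC.sqrt b ∈ Set.centralizer (Set.centralizer (M : Set (H →L[ℂ] H))) := by
    intro z hz
    have hc : Commute b z := hz b hb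
    have := hc.cfc_nnreal NNReal.sqrt
    rw [CFC.sqrt_eq_cfc]
    exact this.symm
  rw [VonNeumannAlgebra.centralizer_centralizer] at h
  exact h

/-- `τ(A²) ≤ τ(B²)` for `0 ≤ A ≤ B` in `M`. -/
theorem sq_mono {A B : H →L[ℂ] H} (hA : A ∈ M) (hB : B ∈ M) (h0 : 0 ≤ A) (h : A ≤ B) :
    τ.toFun (A * A) ≤ τ.toFun (B * B) := by
  have hB0 : 0 ≤ B := h0.trans h
  set a := CFC.sqrt A with ha
  set b := CFC.sqrt B with hb
  have ham : a ∈ M := sqrt_mem hA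
  have hbm : b ∈ M := sqrt_mem hB
  have haa : a * a = A := CFC.sqrt_mul_sqrt_self A h0
  have hbb : b * b = B := CFC.sqrt_mul_sqrt_self B hB0
  have hsa : star a = a := (CFC.sqrt_nonneg A).isSelfAdjoint.star_eq
  have hsb : star b = b := (CFC.sqrt_nonneg B).isSelfAdjoint.star_eq
  have h1 : A * A = star a * A * a := by rw [hsa, ← haa]; simp only [mul_assoc]
  have h2 : star a * B * a = star (b * a) * (b * a) := by
    rw [star_mul, hsb, ← hbb]; simp only [mul_assoc]
  have h3 : (b * a) * star (b * a) = star b * A * b := by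
    rw [star_mul, hsa, hsb, ← haa]; simp only [mul_assoc]
  have h4 : star b * B * b = B * B := by rw [hsb, ← hbb]; simp only [mul_assoc]
  have sm : star a ∈ M := star_mem ham
  have sm' : star b ∈ M := star_mem hbm
  calc τ.toFun (A * A) = τ.toFun (star a * A * a) := by rw [h1]
    _ ≤ τ.toFun (star a * B * a) :=
        τ.mono (mul_mem (mul_mem sm hA) ham) (mul_mem (mul_mem sm hB) ham)
          (star_left_conjugate_nonneg h0 a) (star_left_conjugate_le_conjugate h a)
    _ = τ.toFun (star b * A * b) := by rw [h2, τ.tracial _ (mul_mem hbm ham), h3]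
    _ ≤ τ.toFun (star b * B * b) :=
        τ.mono (mul_mem (mul_mem sm' hA) hbm) (mul_mem (mul_mem sm' hB) hbm)
          (star_left_conjugate_nonneg h0 b) (star_left_conjugate_le_conjugate h b)
    _ = τ.toFun (B * B) := by rw [h4]

/-- `(x+y)*(x+y) ≤ (1+t) x*x + (1+1/t) y*y`. -/
theorem add_sq_le (x y : H →L[ℂ] H) {t : ℝ≥0} (ht : 0 < t) :
    star (x + y) * (x + y) ≤ (((1 + t : ℝ≥0) : ℝ) : ℂ) • (star x * x)
      + (((1 + t⁻¹ : ℝ≥0) : ℝ) : ℂ) • (star y * y) := by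
  rw [← sub_nonneg]
  set s : ℝ := Real.sqrt t with hs
  have hs0 : s ≠ 0 := (Real.sqrt_pos.2 ht).ne'
  have hss : s * s = t := Real.mul_self_sqrt t.2
  have h := star_mul_self_nonneg ((s : ℂ) • x - ((s⁻¹ : ℝ) : ℂ) • y)
  convert h using 1
  have e1 : ((t : ℝ) : ℂ) = (s : ℂ) * s := by rw [← Complex.ofReal_mul, hss]
  have hsC : (s : ℂ) ≠ 0 := by exact_mod_cast hs0
  simp only [star_add, star_sub, star_smul, RCLike.star_def, Complex.conj_ofReal, NNReal.coe_add,
    NNReal.coe_one, NNReal.coe_inv, Complex.ofReal_add, Complex.ofReal_one, e1,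
    Complex.ofReal_inv, map_inv₀, mul_inv]
  simp only [add_mul, mul_add, sub_mul, mul_sub, smul_mul_assoc, mul_smul_comm, add_smul,
    one_smul, smul_smul, smul_sub, inv_mul_cancel₀ hsC, mul_inv_cancel₀ hsC]
  abel

theorem map_comb {A B : H →L[ℂ] H} (hA : A ∈ M) (hB : B ∈ M) (hA0 : 0 ≤ A) (hB0 : 0 ≤ B)
    (c d : ℝ≥0) : τ.toFun (((c : ℝ) : ℂ) • A + ((d : ℝ) : ℂ) • B)
      = c * τ.toFun A + d * τ.toFun B := by
  rw [τ.map_add _ (smul_mem' hA _) _ (smul_mem' hB _) (ofReal_smul_nonneg hA0 c)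
    (ofReal_smul_nonneg hB0 d), τ.map_smul c A hA hA0, τ.map_smul d B hB hB0]

theorem sq_add_le {x y : H →L[ℂ] H} (hx : x ∈ M) (hy : y ∈ M) {t : ℝ≥0} (ht : 0 < t) :
    τ.toFun (star (x + y) * (x + y)) ≤
      (1 + t : ℝ≥0) * τ.toFun (star x * x) + (1 + t⁻¹ : ℝ≥0) * τ.toFun (star y * y) := by
  rw [← τ.map_comb (star_mul_mem hx) (star_mul_mem hy) (star_mul_self_nonneg x)
    (star_mul_self_nonneg y)]
  exact τ.mono (star_mul_mem (add_mem hx hy))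
    (add_mem (smul_mem' (star_mul_mem hx) _) (smul_mem' (star_mul_mem hy) _))
    (star_mul_self_nonneg _) (add_sq_le x y ht)

theorem le_add_of_forall {z a b : ℝ} (ha : 0 ≤ a) (hb : 0 ≤ b)
    (h : ∀ t : ℝ≥0, 0 < t → z ^ 2 ≤ (1 + t) * a ^ 2 + (1 + (t : ℝ)⁻¹) * b ^ 2) : z ≤ a + b := by
  refine le_of_forall_pos_le_add fun ε hε => ?_
  have hε2 : 0 < ε / 2 := half_pos hε
  set p := a + ε / 2 with hp
  set q := b + ε / 2 with hq
  have hp0 : 0 < p := by positivity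
  have hq0 : 0 < q := by positivity
  have h1 := h ⟨q / p, by positivity⟩ (by
    have : 0 < q / p := by positivity
    exact_mod_cast this)
  change z ^ 2 ≤ (1 + q / p) * a ^ 2 + (1 + (q / p)⁻¹) * b ^ 2 at h1
  have h2 : a ^ 2 ≤ p ^ 2 := by gcongr; linarith
  have h3 : b ^ 2 ≤ q ^ 2 := by gcongr; linarith
  have h4 : z ^ 2 ≤ (p + q) ^ 2 := by
    calc z ^ 2 ≤ (1 + q / p) * a ^ 2 + (1 + (q / p)⁻¹) * b ^ 2 := h1
      _ ≤ (1 + q / p) * p ^ 2 + (1 + (q / p)⁻¹) * q ^ 2 := by gcongr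
      _ = (p + q) ^ 2 := by field_simp; ring
  have := (abs_le.1 (abs_le_of_sq_le_sq h4 (by positivity))).2
  linarith

theorem star_smul_mul (c : ℂ) (x : H →L[ℂ] H) :
    star (c • x) * (c • x) = (((‖c‖₊ ^ 2 : ℝ≥0) : ℝ) : ℂ) • (star x * x) := by
  rw [star_smul, smul_mul_assoc, mul_smul_comm, smul_smul]
  congr 1
  rw [RCLike.star_def, Complex.conj_mul']
  push_cast
  rfl

/-- `M ∩ L_2(M) = {x ∈ M : τ(|x|²) < ∞}`, where `|x|² = x*x`. -/
def sub2 : Submodule ℂ (H →L[ℂ] H) where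
  carrier := {x | x ∈ M ∧ τ.toFun (star x * x) < ∞}
  zero_mem' := by
    refine ⟨zero_mem M, ?_⟩
    have := τ.map_smul 0 0 (zero_mem M) le_rfl
    simp only [NNReal.coe_zero, Complex.ofReal_zero, smul_zero, ENNReal.coe_zero, zero_mul] at this
    rw [mul_zero, this]
    exact ENNReal.zero_lt_top
  add_mem' := by
    rintro x y ⟨hx, hx'⟩ ⟨hy, hy'⟩
    refine ⟨add_mem hx hy, (τ.sq_add_le hx hy one_pos).trans_lt ?_⟩
    exact ENNReal.add_lt_top.2 ⟨ENNReal.mul_lt_top ENNReal.coe_lt_top hx',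
      ENNReal.mul_lt_top ENNReal.coe_lt_top hy'⟩
  smul_mem' := by
    rintro c x ⟨hx, hx'⟩
    refine ⟨smul_mem' hx c, ?_⟩
    rw [star_smul_mul, τ.map_smul _ _ (star_mul_mem hx) (star_mul_self_nonneg x)]
    exact ENNReal.mul_lt_top ENNReal.coe_lt_top hx'

/-- `‖x‖_2 = τ(|x|²)^{1/2}`. -/
noncomputable def nrm2 (x : H →L[ℂ] H) : ℝ := (τ.toFun (star x * x)).toReal ^ (1 / 2 : ℝ)

/-- `‖x‖_4 = τ(|x|⁴)^{1/4}`, where `|x|⁴ = (x*x)²`. -/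
noncomputable def nrm4 (x : H →L[ℂ] H) : ℝ := (τ.toFun ((star x * x) ^ 2)).toReal ^ (1 / 4 : ℝ)

theorem nrm2_nonneg (x : H →L[ℂ] H) : 0 ≤ τ.nrm2 x := Real.rpow_nonneg ENNReal.toReal_nonneg _

theorem nrm4_nonneg (x : H →L[ℂ] H) : 0 ≤ τ.nrm4 x := Real.rpow_nonneg ENNReal.toReal_nonneg _

theorem nrm2_sq (x : H →L[ℂ] H) : τ.nrm2 x ^ 2 = (τ.toFun (star x * x)).toReal := by
  rw [nrm2, ← Real.rpow_natCast, ← Real.rpow_mul ENNReal.toReal_nonneg]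
  norm_num

theorem star_sq (x : H →L[ℂ] H) : star (star x * x) * (star x * x) = (star x * x) ^ 2 := by
  rw [(IsSelfAdjoint.star_mul_self x).star_eq, sq]

theorem nrm4_sq (x : H →L[ℂ] H) : τ.nrm4 x ^ 2 = τ.nrm2 (star x * x) := by
  rw [nrm4, nrm2, star_sq, ← Real.rpow_natCast, ← Real.rpow_mul ENNReal.toReal_nonneg]
  norm_num

theorem nrm2_smul (c : ℂ) {x : H →L[ℂ] H} (hx : x ∈ M) : τ.nrm2 (c • x) = ‖c‖ * τ.nrm2 x := by
  rw [nrm2, nrm2, star_smul_mul, τ.map_smul _ _ (star_mul_mem hx) (star_mul_self_nonneg x),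
    ENNReal.toReal_mul, Real.mul_rpow ENNReal.toReal_nonneg ENNReal.toReal_nonneg]
  congr 1
  rw [ENNReal.coe_toReal, NNReal.coe_pow, coe_nnnorm, ← Real.rpow_natCast,
    ← Real.rpow_mul (norm_nonneg c)]
  norm_num

theorem nrm4_smul (c : ℂ) {x : H →L[ℂ] H} (hx : x ∈ M) : τ.nrm4 (c • x) = ‖c‖ * τ.nrm4 x := by
  rw [← pow_left_inj₀ (τ.nrm4_nonneg _) (mul_nonneg (norm_nonneg c) (τ.nrm4_nonneg _))
    two_ne_zero, mul_pow, nrm4_sq, nrm4_sq, star_smul_mul, τ.nrm2_smul _ (star_mul_mem hx)]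
  simp

theorem nrm2_add_le {x y : H →L[ℂ] H} (hx : x ∈ τ.sub2) (hy : y ∈ τ.sub2) :
    τ.nrm2 (x + y) ≤ τ.nrm2 x + τ.nrm2 y := by
  refine le_add_of_forall (τ.nrm2_nonneg x) (τ.nrm2_nonneg y) fun t ht => ?_
  have h := τ.sq_add_le hx.1 hy.1 ht
  have hxf : ((1 + t : ℝ≥0) : ℝ≥0∞) * τ.toFun (star x * x) ≠ ∞ :=
    (ENNReal.mul_lt_top ENNReal.coe_lt_top hx.2).ne
  have hyf : ((1 + t⁻¹ : ℝ≥0) : ℝ≥0∞) * τ.toFun (star y * y) ≠ ∞ :=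
    (ENNReal.mul_lt_top ENNReal.coe_lt_top hy.2).ne
  have h' := ENNReal.toReal_mono (ENNReal.add_ne_top.2 ⟨hxf, hyf⟩) h
  rw [ENNReal.toReal_add hxf hyf, ENNReal.toReal_mul, ENNReal.toReal_mul] at h'
  rw [nrm2_sq, nrm2_sq, nrm2_sq]
  simpa only [ENNReal.coe_toReal, NNReal.coe_add, NNReal.coe_one, NNReal.coe_inv] using h'

theorem sq_mem_sub2 {x : H →L[ℂ] H} :
    x ∈ M → τ.toFun ((star x * x) ^ 2) < ∞ → star x * x ∈ τ.sub2 := fun hx h =>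
  ⟨star_mul_mem hx, by rwa [star_sq]⟩

/-- The analogue for `4` of `sq_add_le`. -/
theorem four_add_le {x y : H →L[ℂ] H} (hx : x ∈ M) (hy : y ∈ M) {t : ℝ≥0} (ht : 0 < t) :
    τ.toFun ((star (x + y) * (x + y)) ^ 2) ≤
      τ.toFun (star ((((1 + t : ℝ≥0) : ℝ) : ℂ) • (star x * x)
        + (((1 + t⁻¹ : ℝ≥0) : ℝ) : ℂ) • (star y * y)) * ((((1 + t : ℝ≥0) : ℝ) : ℂ) • (star x * x)
        + (((1 + t⁻¹ : ℝ≥0) : ℝ) : ℂ) • (star y * y))) := by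
  have hB := add_mem (smul_mem' (star_mul_mem hx) (((1 + t : ℝ≥0) : ℝ) : ℂ))
    (smul_mem' (star_mul_mem hy) (((1 + t⁻¹ : ℝ≥0) : ℝ) : ℂ))
  have hB0 : 0 ≤ (((1 + t : ℝ≥0) : ℝ) : ℂ) • (star x * x)
      + (((1 + t⁻¹ : ℝ≥0) : ℝ) : ℂ) • (star y * y) :=
    add_nonneg (ofReal_smul_nonneg (star_mul_self_nonneg x) _)
      (ofReal_smul_nonneg (star_mul_self_nonneg y) _)
  rw [hB0.isSelfAdjoint.star_eq, sq]
  exact τ.sq_mono (star_mul_mem (add_mem hx hy)) hB (star_mul_self_nonneg _) (add_sq_le x y ht)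

/-- `M ∩ L_4(M) = {x ∈ M : τ(|x|⁴) < ∞}`, where `|x|⁴ = (x*x)²`. -/
def sub4 : Submodule ℂ (H →L[ℂ] H) where
  carrier := {x | x ∈ M ∧ τ.toFun ((star x * x) ^ 2) < ∞}
  zero_mem' := by
    refine ⟨zero_mem M, ?_⟩
    have := (τ.sub2.zero_mem).2
    simpa using this
  add_mem' := by
    rintro x y ⟨hx, hx'⟩ ⟨hy, hy'⟩
    refine ⟨add_mem hx hy, (τ.four_add_le hx hy one_pos).trans_lt ?_⟩
    exact (τ.sub2.add_mem (τ.sub2.smul_mem _ (τ.sq_mem_sub2 hx hx'))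
      (τ.sub2.smul_mem _ (τ.sq_mem_sub2 hy hy'))).2
  smul_mem' := by
    rintro c x ⟨hx, hx'⟩
    refine ⟨smul_mem' hx c, ?_⟩
    rw [← star_sq, star_smul_mul]
    exact (τ.sub2.smul_mem _ (τ.sq_mem_sub2 hx hx')).2

theorem nrm4_add_le {x y : H →L[ℂ] H} (hx : x ∈ τ.sub4) (hy : y ∈ τ.sub4) :
    τ.nrm4 (x + y) ≤ τ.nrm4 x + τ.nrm4 y := by
  refine le_add_of_forall (τ.nrm4_nonneg x) (τ.nrm4_nonneg y) fun t ht => ?_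
  have h := τ.four_add_le hx.1 hy.1 ht
  have hX := τ.sub2.smul_mem (((1 + t : ℝ≥0) : ℝ) : ℂ) (τ.sq_mem_sub2 hx.1 hx.2)
  have hY := τ.sub2.smul_mem (((1 + t⁻¹ : ℝ≥0) : ℝ) : ℂ) (τ.sq_mem_sub2 hy.1 hy.2)
  have h1 : τ.nrm2 (star (x + y) * (x + y)) ≤ _ :=
    (Real.rpow_le_rpow ENNReal.toReal_nonneg
      (by rw [star_sq]; exact ENNReal.toReal_mono (τ.sub2.add_mem hX hY).2.ne h)
      (by norm_num)).trans (τ.nrm2_add_le hX hY)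
  rw [τ.nrm2_smul _ (star_mul_mem hx.1), τ.nrm2_smul _ (star_mul_mem hy.1)] at h1
  rw [nrm4_sq, nrm4_sq, nrm4_sq]
  refine h1.trans_eq ?_
  congr 2
  · rw [Complex.norm_real, Real.norm_of_nonneg (NNReal.coe_nonneg _)]; simp
  · rw [Complex.norm_real, Real.norm_of_nonneg (NNReal.coe_nonneg _)]; simp

/-- The vector space `M ∩ L_2(M)`, to be normed by `‖·‖_2`. -/
def PreL2 : Type _ := τ.sub2

/-- The vector space `M ∩ L_4(M)`, to be normed by `‖·‖_4`. -/
def PreL4 : Type _ := τ.sub4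

instance : AddCommGroup τ.PreL2 := inferInstanceAs (AddCommGroup τ.sub2)

instance : Module ℂ τ.PreL2 := inferInstanceAs (Module ℂ τ.sub2)

instance : AddCommGroup τ.PreL4 := inferInstanceAs (AddCommGroup τ.sub4)

instance : Module ℂ τ.PreL4 := inferInstanceAs (Module ℂ τ.sub4)

/-- The underlying operator. -/
def PreL2.op {τ : NSFTrace M} (x : τ.PreL2) : H →L[ℂ] H := Subtype.val x

/-- The underlying operator. -/
def PreL4.op {τ : NSFTrace M} (x : τ.PreL4) : H →L[ℂ] H := Subtype.val x

noncomputable instance : Norm τ.PreL2 := ⟨fun x => τ.nrm2 x.op⟩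

noncomputable instance : Norm τ.PreL4 := ⟨fun x => τ.nrm4 x.op⟩

theorem core2 : SeminormedSpace.Core ℂ τ.PreL2 where
  norm_nonneg _ := τ.nrm2_nonneg _
  norm_smul c x := τ.nrm2_smul c (Subtype.prop x).1
  norm_triangle x y := τ.nrm2_add_le (Subtype.prop x) (Subtype.prop y)

theorem core4 : SeminormedSpace.Core ℂ τ.PreL4 where
  norm_nonneg _ := τ.nrm4_nonneg _
  norm_smul c x := τ.nrm4_smul c (Subtype.prop x).1
  norm_triangle x y := τ.nrm4_add_le (Subtype.prop x) (Subtype.prop y)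

noncomputable instance : SeminormedAddCommGroup τ.PreL2 := .ofCore τ.core2

noncomputable instance : NormedSpace ℂ τ.PreL2 :=
  ⟨fun c x => (τ.core2.norm_smul c x).le⟩

noncomputable instance : SeminormedAddCommGroup τ.PreL4 := .ofCore τ.core4

noncomputable instance : NormedSpace ℂ τ.PreL4 :=
  ⟨fun c x => (τ.core4.norm_smul c x).le⟩

/-- The noncommutative space `L_2(M)`: the completion of `M ∩ L_2(M)` for `‖·‖_2`. -/
abbrev L2 : Type _ := UniformSpace.Completion τ.PreL2

/-- The noncommutative space `L_4(M)`: the completion of `M ∩ L_4(M)` for `‖·‖_4`. -/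
abbrev L4 : Type _ := UniformSpace.Completion τ.PreL4

/-- `x = a y b` for `a, b ∈ L_4(M)`, `y ∈ M`, `x ∈ L_2(M)`: the product of operators of `M`,
extended by continuity to `L_4(M) × L_4(M) → L_2(M)` (Hölder), i.e. `x = lim uᵢ y vᵢ` in `L_2(M)`
where `uᵢ, vᵢ ∈ M ∩ L_4(M)` tend to `a` and `b` in `L_4(M)`. -/
def IsProd (a : τ.L4) (y : H →L[ℂ] H) (b : τ.L4) (x : τ.L2) : Prop :=
  ∃ (u v : ℕ → τ.PreL4) (w : ℕ → τ.PreL2),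
    (∀ i, (w i).op = (u i).op * y * (v i).op) ∧
    Tendsto (fun i => (u i : τ.L4)) atTop (𝓝 a) ∧
    Tendsto (fun i => (v i : τ.L4)) atTop (𝓝 b) ∧
    Tendsto (fun i => (w i : τ.L2)) atTop (𝓝 x)

end NSFTrace

end Trace

/-! ### The tensor product `N = L_∞(Ω, μ) ⊗̄ M` and the space `L_2(N; ℓ_∞)` -/

section Tensor

variable {H : Type*} [NormedAddCommGroup H] [InnerProductSpace ℂ H] [CompleteSpace H]
variable {Ω : Type*} [MeasurableSpace Ω]

/-- The operators `g ⊗ 1` (`g ∈ L_∞(Ω, μ)`) and `1 ⊗ m` (`m ∈ M`) on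
`L_2(Ω; H) = L_2(Ω) ⊗ H`. -/
def tensorGenerators (M : VonNeumannAlgebra H) (μ : Measure Ω) :
    Set (Lp H 2 μ →L[ℂ] Lp H 2 μ) :=
  {T | ∃ g : Ω → ℂ, MemLp g ∞ μ ∧ ∀ ξ : Lp H 2 μ, T ξ =ᵐ[μ] fun t => g t • ξ t} ∪
  {T | ∃ m ∈ M, ∀ ξ : Lp H 2 μ, T ξ =ᵐ[μ] fun t => m (ξ t)}

/-- The von Neumann algebra `L_∞(Ω, μ) ⊗̄ M` acting on `L_2(Ω; H)`: the double commutant of the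
elementary tensors (`StarSubalgebra.centralizer` is the commutant of a set and its adjoints). -/
noncomputable def tensorVN (M : VonNeumannAlgebra H) (μ : Measure Ω) :
    VonNeumannAlgebra (Lp H 2 μ) where
  toStarSubalgebra := StarSubalgebra.centralizer ℂ
    (StarSubalgebra.centralizer ℂ (tensorGenerators M μ) : Set (Lp H 2 μ →L[ℂ] Lp H 2 μ))
  centralizer_centralizer' := by
    change Set.centralizer (Set.centralizer
      ((StarSubalgebra.centralizer ℂ (StarSubalgebra.centralizer ℂ (tensorGenerators M μ) :
        Set (Lp H 2 μ →L[ℂ] Lp H 2 μ)) : StarSubalgebra ℂ (Lp H 2 μ →L[ℂ] Lp H 2 μ)) :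
        Set (Lp H 2 μ →L[ℂ] Lp H 2 μ))) = _
    rw [StarSubalgebra.coe_centralizer_centralizer, Set.centralizer_centralizer_centralizer]
    exact (StarSubalgebra.coe_centralizer_centralizer ℂ _).symm

/-- `y : Ω → M` is a decomposition of the operator `Y` on `L_2(Ω; H)` into fibres:
`(Yξ)(t) = y(t) ξ(t)` for almost every `t`, for every `ξ`. This is how elements of
`L_∞(Ω, μ) ⊗̄ M` are viewed as `M`-valued functions. -/
def IsFibre (M : VonNeumannAlgebra H) (μ : Measure Ω) (Y : Lp H 2 μ →L[ℂ] Lp H 2 μ)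
    (y : Ω → H →L[ℂ] H) : Prop :=
  (∀ t, y t ∈ M) ∧ ∀ ξ : Lp H 2 μ, Y ξ =ᵐ[μ] fun t => y t (ξ t)

variable {M : VonNeumannAlgebra H} (τ : NSFTrace M) (μ : Measure Ω)

/-- `L_2(N)` for `N = L_∞(Ω, μ) ⊗̄ M` with the tensor trace, as the space `L_2(Ω; L_2(M))`. -/
abbrev L2N : Type _ := Lp τ.L2 2 μ

/-- `L_4(N)` for `N = L_∞(Ω, μ) ⊗̄ M` with the tensor trace, as the space `L_4(Ω; L_4(M))`. -/
abbrev L4N : Type _ := Lp τ.L4 4 μ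

/-- `x = a Y b` for `a, b ∈ L_4(N)`, `Y ∈ N`, `x ∈ L_2(N)`: fibrewise product. -/
def IsProdN (a : L4N τ μ) (Y : tensorVN M μ) (b : L4N τ μ) (x : L2N τ μ) : Prop :=
  ∃ y : Ω → H →L[ℂ] H, IsFibre M μ Y y ∧ ∀ᵐ t ∂μ, τ.IsProd (a t) (y t) (b t) (x t)

/-- The norm of a family `x = (x_i)` in `L_2(N; ℓ_∞(ι))`: the infimum of
`sup_i ‖Y_i‖_∞ ‖a‖_4 ‖b‖_4` over all factorizations `x_i = a Y_i b` with `a, b ∈ L_4(N)` and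
`(Y_i)` a bounded family in `N`. It is `∞` if there is no factorization, i.e. if `x` is not in
`L_2(N; ℓ_∞(ι))`. -/
noncomputable def maxNorm {ι : Type*} (x : ι → L2N τ μ) : ℝ≥0∞ :=
  ⨅ (a : L4N τ μ) (b : L4N τ μ) (Y : ι → tensorVN M μ)
    (_ : ∃ C : ℝ, ∀ i, ‖(Y i : Lp H 2 μ →L[ℂ] Lp H 2 μ)‖ ≤ C)
    (_ : ∀ i, IsProdN τ μ a (Y i) b (x i)),
    (⨆ i, ‖(Y i : Lp H 2 μ →L[ℂ] Lp H 2 μ)‖ₑ) * ‖a‖ₑ * ‖b‖ₑ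

end Tensor

/-! ### The compact group `G = ∏ G_k` and its character system -/

section Group

/-- The irreducible complex characters of a finite group. -/
def irrChars (K : Type*) [Group K] : Set (K → ℂ) :=
  {φ | ∃ (d : ℕ) (ρ : Representation ℂ K (Fin d → ℂ)), ρ.IsIrreducible ∧ φ = ρ.character}

variable (Γ : ℕ → Type*) [∀ k, Group (Γ k)]

/-- `p_k`, the number of conjugacy classes of `G_k`. -/
noncomputable def numClasses (k : ℕ) : ℕ := Nat.card (ConjClasses (Γ k))

/-- `P_0 = 1`, `P_{k+1} = p_k P_k`. -/
noncomputable def bigP (k : ℕ) : ℕ := ∏ i ∈ Finset.range k, numClasses Γ i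

/-- The digits of the expansion `n = ∑ n_k P_k`, `0 ≤ n_k ≤ p_k - 1`. -/
noncomputable def dig (n k : ℕ) : ℕ := n / bigP Γ k % numClasses Γ k

/-- `n^{(s)} = ∑_{k ≥ s} n_k P_k`. -/
noncomputable def tail (s n : ℕ) : ℕ := ∑ᶠ (k : ℕ) (_ : s ≤ k), dig Γ n k * bigP Γ k

/-- The set of `n` with `|n| = A`, where `|n| = max {k : n_k ≠ 0}`. -/
def block (A : ℕ) : Set ℕ := {n | IsGreatest {k | dig Γ n k ≠ 0} A}

/-- `r_k^0, …, r_k^{p_k - 1}` is an enumeration of the irreducible characters of `G_k` with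
`r_k^0 = 1`, for every `k`. -/
def IsCharacterSystem (r : ∀ k, ℕ → Γ k → ℂ) : Prop :=
  ∀ k, Set.BijOn (r k) (Set.Iio (numClasses Γ k)) (irrChars (Γ k)) ∧ r k 0 = fun _ => 1

variable {Γ}

/-- `χ_n(x) = ∏_k r_k^{n_k}(x_k)` (all but finitely many factors are `1`). -/
noncomputable def chi (r : ∀ k, ℕ → Γ k → ℂ) (n : ℕ) (x : ∀ k, Γ k) : ℂ :=
  ∏ᶠ k, r k (dig Γ n k) (x k)

/-- `J_s(y)`: the product of the conjugacy classes of `y_0, …, y_{s-1}` and of the whole groups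
`G_s, G_{s+1}, …`. -/
def J (s : ℕ) (y : ∀ k, Γ k) : Set (∀ k, Γ k) := {x | ∀ i < s, IsConj (y i) (x i)}

variable (Γ)

/-- The normalized Haar measure of `G`: the product of the uniform measures on the `G_k`. -/
noncomputable def haarG [∀ k, MeasurableSpace (Γ k)] : Measure (∀ k, Γ k) :=
  Measure.infinitePi fun k => ProbabilityTheory.uniformOn (Set.univ : Set (Γ k))

variable {Γ}

/-- `y ↦ μ(J_s(y))⁻¹ ∫_{J_s(y)} f(x) χ_{n^{(s)}}(y) conj χ_{n^{(s)}}(x) dμ(x)`. -/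
noncomputable def avg [∀ k, MeasurableSpace (Γ k)] {E : Type*} [NormedAddCommGroup E]
    [NormedSpace ℂ E] (r : ∀ k, ℕ → Γ k → ℂ) (s n : ℕ) (f : (∀ k, Γ k) → E) (y : ∀ k, Γ k) : E :=
  (((haarG Γ).real (J s y) : ℂ))⁻¹ •
    ∫ x in J s y, (chi r (tail Γ s n) y * conj (chi r (tail Γ s n) x)) • f x ∂(haarG Γ)

end Group

/-!
Fix `s` and `N` with `n < P_N`, and put `K = max N s`. On `G` consider the products of normalized
indicators of conjugacy classes in the coordinates `k < s` with irreducible characters in the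
coordinates `s ≤ k < K`. They form a finite orthonormal system `(φ_m)` in `L_2(G)`. At each point
`y`, `T_n f(y) = φ_m(y) v_m` with `v_m = ∫ conj φ_m • f`, where `m` is given by the classes of
`y_k` for `k < s` and by the digits of `n` for `s ≤ k < K`.

Finitely many elements `x_d` of `L_2(M)` factor as `x_d = a y_d b` with the same `a`, `b`,
`‖y_d‖ ≤ 1` and `‖a‖⁴`, `‖b‖⁴` arbitrarily close to `∑ ‖x_d‖²`: write the family as a series of
families in `M` whose square functions are summable in `L_2(M)`, and let `a` and `b` be the square
roots of the sums of the square functions for the adjoints and for the family itself. As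
`T_n f` is a function of finitely many coordinates of `y`, doing this at each point with
`x_m = φ_m(y) v_m` gives `‖sup⁺ T_n f‖² ≤ ∫ ∑ ‖φ_m(y) v_m‖² dμ(y) = ∑ ‖v_m‖²`. Bessel's inequality
for functions with values in the Hilbert space `L_2(M)` bounds the last sum by `‖f‖²`.
-/

/-! ### Weak limits along an ultrafilter -/

section WeakLimits

variable {ι E : Type*} [NormedAddCommGroup E] [InnerProductSpace ℂ E]

/-- `Y` is the limit of the family `y` in the weak operator topology along the filter `U`. -/
def IsWeakLim (U : Filter ι) (y : ι → E →L[ℂ] E) (Y : E →L[ℂ] E) : Prop :=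
  ∀ ξ η : E, Tendsto (fun k => inner ℂ η (y k ξ)) U (𝓝 (inner ℂ η (Y ξ)))

theorem isWeakLim_of_tendsto {U : Filter ι} {y : ι → E →L[ℂ] E} {Y : E →L[ℂ] E}
    (h : Tendsto y U (𝓝 Y)) : IsWeakLim U y Y := fun ξ η =>
  ((innerSL ℂ η).continuous.tendsto _).comp
    (((ContinuousLinearMap.apply ℂ E ξ).continuous.tendsto _).comp h)

namespace IsWeakLim

variable {U : Filter ι} {y z : ι → E →L[ℂ] E} {Y Z : E →L[ℂ] E}

theorem unique [U.NeBot] (h : IsWeakLim U y Y) (h' : IsWeakLim U y Z) : Y = Z := by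
  ext ξ
  exact ext_inner_left ℂ fun η => tendsto_nhds_unique (h ξ η) (h' ξ η)

theorem sub (h : IsWeakLim U y Y) (h' : IsWeakLim U z Z) :
    IsWeakLim U (fun k => y k - z k) (Y - Z) := by
  intro ξ η
  simpa [inner_sub_right] using (h ξ η).sub (h' ξ η)

theorem norm_apply_le [U.NeBot] (h : IsWeakLim U y Y) {ξ : E} {c : ℝ}
    (hc : ∀ᶠ k in U, ‖y k ξ‖ ≤ c) : ‖Y ξ‖ ≤ c := by
  have inner_le : RCLike.re (inner ℂ (Y ξ) (Y ξ)) ≤ ‖Y ξ‖ * c :=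
    le_of_tendsto ((RCLike.continuous_re.tendsto _).comp (h ξ (Y ξ)))
      (hc.mono fun k hk => (re_inner_le_norm _ _).trans (by gcongr))
  obtain ⟨k, hk⟩ := hc.exists
  rw [inner_self_eq_norm_mul_norm] at inner_le
  nlinarith [norm_nonneg (Y ξ), (norm_nonneg _).trans hk]

end IsWeakLim

variable [CompleteSpace E]

theorem exists_weakLimit_of_norm_le (U : Ultrafilter ι) {z : ι → E} {C : ℝ}
    (hz : ∀ᶠ k in U, ‖z k‖ ≤ C) :
    ∃ ζ : E, ‖ζ‖ ≤ C ∧ ∀ η, Tendsto (fun k => inner ℂ η (z k)) U (𝓝 (inner ℂ η ζ)) := by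
  let w : ι → WeakDual ℂ E := fun k => StrongDual.toWeakDual (InnerProductSpace.toDual ℂ E (z k))
  have w_mem : ∀ᶠ k in U,
      w k ∈ WeakDual.toStrongDual ⁻¹' Metric.closedBall (0 : StrongDual ℂ E) C := by
    filter_upwards [hz] with k hk
    rw [Set.mem_preimage, mem_closedBall_zero_iff]
    simpa [w] using hk
  obtain ⟨φ, hφ, hlim⟩ := (WeakDual.isCompact_closedBall (𝕜 := ℂ) (E := E) 0 C).ultrafilter_le_nhds
    (U.map w) (le_principal_iff.2 (mem_map.2 w_mem))
  refine ⟨(InnerProductSpace.toDual ℂ E).symm (WeakDual.toStrongDual φ), by simpa using hφ,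
    fun η => ?_⟩
  have hη : Tendsto (fun k => w k η) U (𝓝 (φ η)) :=
    ((WeakDual.eval_continuous η).tendsto φ).comp hlim
  refine (((Complex.continuous_conj.tendsto _).comp hη).congr fun k => ?_).trans_eq ?_
  · simp [w]
  · rw [← inner_conj_symm η, InnerProductSpace.toDual_symm_apply]
    rfl

theorem exists_isWeakLim_of_norm_le (U : Ultrafilter ι) {y : ι → E →L[ℂ] E} {C : ℝ}
    (hC : 0 ≤ C) (hy : ∀ k, ‖y k‖ ≤ C) : ∃ Y : E →L[ℂ] E, ‖Y‖ ≤ C ∧ IsWeakLim U y Y := by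
  choose Z Z_le hZ using fun ξ => exists_weakLimit_of_norm_le U (z := fun k => y k ξ)
    (.of_forall fun k => (y k).le_of_opNorm_le (hy k) ξ)
  let L : E →ₗ[ℂ] E :=
    { toFun := Z
      map_add' := fun ξ ξ' => ext_inner_left ℂ fun η => by
        refine tendsto_nhds_unique (hZ (ξ + ξ') η) ?_
        simpa [inner_add_right] using (hZ ξ η).add (hZ ξ' η)
      map_smul' := fun c ξ => ext_inner_left ℂ fun η => by
        refine tendsto_nhds_unique (hZ (c • ξ) η) ?_
        simpa [inner_smul_right] using (hZ ξ η).const_mul c }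
  exact ⟨L.mkContinuous C Z_le, L.mkContinuous_norm_le hC Z_le, hZ⟩

theorem mem_of_forall_commute {M : VonNeumannAlgebra E} {x : E →L[ℂ] E}
    (h : ∀ g, (∀ m ∈ M, Commute m g) → Commute x g) : x ∈ M := by
  rw [← M.commutant_commutant, VonNeumannAlgebra.mem_commutant_iff]
  exact fun g hg => (h g fun m hm => VonNeumannAlgebra.mem_commutant_iff.1 hg m hm).symm

theorem inner_apply_eq_inner_star_apply (x : E →L[ℂ] E) (ξ η : E) :
    inner ℂ η (x ξ) = inner ℂ (star x η) ξ := by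
  rw [ContinuousLinearMap.star_eq_adjoint, ContinuousLinearMap.adjoint_inner_left]

namespace IsWeakLim

variable {U : Filter ι} {y : ι → E →L[ℂ] E} {Y : E →L[ℂ] E}

theorem mul_mul (h : IsWeakLim U y Y) (a b : E →L[ℂ] E) :
    IsWeakLim U (fun k => a * y k * b) (a * Y * b) := by
  intro ξ η
  simpa only [mul_apply_eq_comp, inner_apply_eq_inner_star_apply a] using
    h (b ξ) (star a η)

theorem mem [U.NeBot] {M : VonNeumannAlgebra E} (h : IsWeakLim U y Y) (hy : ∀ k, y k ∈ M) :
    Y ∈ M := by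
  refine mem_of_forall_commute fun g hg => unique (U := U) (y := fun k => y k * g) ?_ ?_
  · simpa using h.mul_mul 1 g
  · have := h.mul_mul g 1
    simp only [mul_one] at this
    rwa [funext fun k => (hg (y k) (hy k)).eq]

end IsWeakLim

end WeakLimits

/-! ### Factorization of operators -/

section Order

open scoped ComplexOrder

variable {H : Type*} [NormedAddCommGroup H] [InnerProductSpace ℂ H]

theorem nonneg_iff_forall_inner_nonneg {x : H →L[ℂ] H} : 0 ≤ x ↔ ∀ ξ, 0 ≤ inner ℂ ξ (x ξ) := by
  rw [ContinuousLinearMap.nonneg_iff_isPositive, ContinuousLinearMap.isPositive_iff_complex]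
  refine forall_congr' fun ξ => ?_
  rw [← inner_conj_symm ξ (x ξ), starRingEnd_apply, star_nonneg_iff]
  simp [Complex.ext_iff, Complex.nonneg_iff, and_comm, eq_comm]

namespace IsWeakLim

variable {ι : Type*} {U : Filter ι} [U.NeBot] {y : ι → H →L[ℂ] H} {Y : H →L[ℂ] H}

theorem nonneg (h : IsWeakLim U y Y) (hy : ∀ᶠ k in U, 0 ≤ y k) : 0 ≤ Y :=
  nonneg_iff_forall_inner_nonneg.2 fun ξ => ge_of_tendsto (h ξ ξ)
    (hy.mono fun _ hk => nonneg_iff_forall_inner_nonneg.1 hk ξ)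

end IsWeakLim

variable [CompleteSpace H]

theorem IsWeakLim.isLUB {ι : Type*} [Preorder ι] {U : Filter ι} [U.NeBot] {y : ι → H →L[ℂ] H}
    {Y : H →L[ℂ] H} (hU : U ≤ atTop) (h : IsWeakLim U y Y) (hy : Monotone y) :
    IsLUB (Set.range y) Y := by
  refine ⟨?_, fun Z hZ => sub_nonneg.1 ?_⟩
  · rintro _ ⟨k, rfl⟩
    have hk : ∀ᶠ l in U, 0 ≤ y l - y k :=
      hU ((eventually_ge_atTop k).mono fun l hl => sub_nonneg.2 (hy hl))
    exact sub_nonneg.1 ((h.sub (isWeakLim_of_tendsto tendsto_const_nhds)).nonneg hk)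
  · exact ((isWeakLim_of_tendsto tendsto_const_nhds).sub h).nonneg
      (.of_forall fun k => sub_nonneg.2 (hZ ⟨k, rfl⟩))

theorem inner_star_mul_self_apply (x : H →L[ℂ] H) (ξ : H) :
    inner ℂ ξ ((star x * x) ξ) = (‖x ξ‖ ^ 2 : ℝ) := by
  rw [mul_apply_eq_comp, inner_apply_eq_inner_star_apply, star_star, inner_self_eq_norm_sq_to_K]
  norm_cast

theorem star_mul_self_le_iff {x y : H →L[ℂ] H} :
    star x * x ≤ star y * y ↔ ∀ ξ, ‖x ξ‖ ≤ ‖y ξ‖ := by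
  rw [← sub_nonneg, nonneg_iff_forall_inner_nonneg]
  refine forall_congr' fun ξ => ?_
  rw [sub_apply, inner_sub_right, inner_star_mul_self_apply, inner_star_mul_self_apply,
    ← Complex.ofReal_sub, Complex.zero_le_real, sub_nonneg,
    pow_le_pow_iff_left₀ (norm_nonneg _) (norm_nonneg _) two_ne_zero]

theorem IsWeakLim.star_mul_self_le {ι : Type*} {U : Filter ι} [U.NeBot] {y : ι → H →L[ℂ] H}
    {X Y : H →L[ℂ] H} (h : IsWeakLim U y Y) (hy : ∀ᶠ k in U, star (y k) * y k ≤ X) :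
    star Y * Y ≤ X := by
  obtain ⟨k, hk⟩ := hy.exists
  have hX : 0 ≤ X := (star_mul_self_nonneg (y k)).trans hk
  have star_sqrt_mul : star (CFC.sqrt X) * CFC.sqrt X = X := by
    rw [(CFC.sqrt_nonneg X).isSelfAdjoint.star_eq, CFC.sqrt_mul_sqrt_self X hX]
  rw [← star_sqrt_mul] at hy ⊢
  exact star_mul_self_le_iff.2 fun ξ =>
    h.norm_apply_le (hy.mono fun k hk => star_mul_self_le_iff.1 hk ξ)

theorem norm_sqrt_apply_sq {P : H →L[ℂ] H} (hP : 0 ≤ P) (ξ : H) :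
    ‖CFC.sqrt P ξ‖ ^ 2 = (inner ℂ ξ (P ξ)).re := by
  have h := inner_star_mul_self_apply (CFC.sqrt P) ξ
  rw [(CFC.sqrt_nonneg P).isSelfAdjoint.star_eq, CFC.sqrt_mul_sqrt_self P hP] at h
  rw [h, Complex.ofReal_re]

end Order

section Regularization

open scoped Ring

variable {H : Type*} [NormedAddCommGroup H] [InnerProductSpace ℂ H]
  {a x : H →L[ℂ] H} {δ : ℝ}

theorem inner_add_smul_one_apply_re (a : H →L[ℂ] H) (δ : ℝ) (ξ : H) :
    (inner ℂ ξ ((a + δ • 1) ξ)).re = (inner ℂ ξ (a ξ)).re + δ * ‖ξ‖ ^ 2 := by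
  simp [inner_smul_right_eq_smul, ← inner_self_eq_norm_sq (𝕜 := ℂ) ξ]

theorem norm_apply_le_norm_add_smul_one_apply (ha : 0 ≤ a) (hδ : 0 ≤ δ) (ξ : H) :
    ‖a ξ‖ ≤ ‖(a + δ • 1) ξ‖ := by
  have h : 0 ≤ RCLike.re (inner ℂ (a ξ) (δ • ξ)) := by
    rw [inner_smul_right_eq_smul, RCLike.smul_re]
    exact mul_nonneg hδ (((a.nonneg_iff_isPositive).1 ha).re_inner_nonneg_left ξ)
  refine le_of_sq_le_sq ?_ (norm_nonneg _)
  rw [add_apply, smul_apply, one_apply_eq_self, @norm_add_sq ℂ]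
  linarith [sq_nonneg ‖δ • ξ‖]

theorem norm_mul_ringInverse_le_one (ha : IsUnit a) (h : ∀ ξ, ‖x ξ‖ ≤ ‖a ξ‖) :
    ‖x * a⁻¹ʳ‖ ≤ 1 := by
  refine ContinuousLinearMap.opNorm_le_bound _ zero_le_one fun ξ => ?_
  calc ‖x (a⁻¹ʳ ξ)‖ ≤ ‖(a * a⁻¹ʳ) ξ‖ := h _
    _ = 1 * ‖ξ‖ := by rw [Ring.mul_inverse_cancel a ha, one_apply_eq_self, one_mul]

variable [CompleteSpace H]

theorem isStrictlyPositive_add_smul_one (ha : 0 ≤ a) (hδ : 0 < δ) :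
    IsStrictlyPositive (a + δ • 1) :=
  .nonneg_add ha (isStrictlyPositive_one.smul hδ)

theorem ringInverse_mem {M : VonNeumannAlgebra H} (ha : a ∈ M) : a⁻¹ʳ ∈ M := by
  refine mem_of_forall_commute fun g hg => ?_
  by_cases hu : IsUnit a
  · obtain ⟨u, rfl⟩ := hu
    rw [Ring.inverse_unit]
    exact (hg _ ha).units_inv_left
  · rw [Ring.inverse_non_unit a hu]
    exact Commute.zero_left g

end Regularization

section Factorization

open scoped Ring

variable {H : Type*} [NormedAddCommGroup H] [InnerProductSpace ℂ H] [CompleteSpace H]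
  {M : VonNeumannAlgebra H} {a b x : H →L[ℂ] H}

theorem norm_inner_mul_mul_apply_le {t : H →L[ℂ] H} (ha : IsSelfAdjoint a) (ht : ‖t‖ ≤ 1)
    (ξ η : H) : ‖inner ℂ η ((a * t * b) ξ)‖ ≤ ‖a η‖ * ‖b ξ‖ := by
  have h : inner ℂ η ((a * t * b) ξ) = inner ℂ (a η) (t (b ξ)) := by
    rw [mul_assoc, mul_apply_eq_comp, inner_apply_eq_inner_star_apply a, ha.star_eq,
      mul_apply_eq_comp]
  rw [h]
  exact (norm_inner_le_norm _ _).trans (by gcongr; simpa using t.le_of_opNorm_le ht (b ξ))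

theorem norm_ringInverse_mul_mul_ringInverse_le_one (ha : IsSelfAdjoint a) (hau : IsUnit a)
    (hbu : IsUnit b) (h : ∀ ξ η, ‖inner ℂ η (x ξ)‖ ≤ ‖a η‖ * ‖b ξ‖) :
    ‖a⁻¹ʳ * x * b⁻¹ʳ‖ ≤ 1 := by
  refine ContinuousLinearMap.opNorm_le_of_re_inner_le zero_le_one fun ξ η hξ hη => ?_
  have inner_eq : inner ℂ η ((a⁻¹ʳ * x * b⁻¹ʳ) ξ) = inner ℂ (a⁻¹ʳ η) (x (b⁻¹ʳ ξ)) := by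
    rw [mul_assoc, mul_apply_eq_comp, inner_apply_eq_inner_star_apply a⁻¹ʳ,
      ha.ringInverse.star_eq, mul_apply_eq_comp]
  have cancel {c : H →L[ℂ] H} (hc : IsUnit c) (ζ : H) : c (c⁻¹ʳ ζ) = ζ := by
    rw [← mul_apply_eq_comp, Ring.mul_inverse_cancel c hc, one_apply_eq_self]
  rw [inner_re_symm, inner_eq]
  calc RCLike.re (inner ℂ (a⁻¹ʳ η) (x (b⁻¹ʳ ξ))) ≤ ‖inner ℂ (a⁻¹ʳ η) (x (b⁻¹ʳ ξ))‖ :=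
        RCLike.re_le_norm _
    _ ≤ ‖a (a⁻¹ʳ η)‖ * ‖b (b⁻¹ʳ ξ)‖ := h _ _
    _ = 1 := by rw [cancel hau, cancel hbu, hξ, hη, one_mul]

theorem norm_mul_mul_sub_add_smul_one_le {y : H →L[ℂ] H} (hy : ‖y‖ ≤ 1) {δ : ℝ} (hδ : 0 ≤ δ) :
    ‖a * y * b - (a + δ • 1) * y * (b + δ • 1)‖ ≤ δ * (‖a‖ + ‖b‖ + δ) := by
  have e : a * y * b - (a + δ • 1) * y * (b + δ • 1) = -(δ • (a * y + y * b + δ • y)) := by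
    simp only [add_mul, mul_add, smul_mul_assoc, mul_smul_comm, one_mul, mul_one, smul_add,
      smul_smul]
    abel
  have norm_mul_le_left : ‖a * y‖ ≤ ‖a‖ :=
    (norm_mul_le _ _).trans (mul_le_of_le_one_right (norm_nonneg _) hy)
  have norm_mul_le_right : ‖y * b‖ ≤ ‖b‖ :=
    (norm_mul_le _ _).trans (mul_le_of_le_one_left (norm_nonneg _) hy)
  have norm_smul_le : ‖δ • y‖ ≤ δ := by
    rw [norm_smul, Real.norm_of_nonneg hδ]
    exact mul_le_of_le_one_right hδ hy
  rw [e, norm_neg, norm_smul, Real.norm_of_nonneg hδ]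
  gcongr
  exact norm_add₃_le.trans (by gcongr)

/-- Douglas' factorization theorem, for a sesquilinear majorant. -/
theorem exists_eq_mul_mul_of_norm_inner_le (ha : a ∈ M) (hb : b ∈ M) (hx : x ∈ M) (ha0 : 0 ≤ a)
    (hb0 : 0 ≤ b) (h : ∀ ξ η, ‖inner ℂ η (x ξ)‖ ≤ ‖a η‖ * ‖b ξ‖) :
    ∃ y ∈ M, ‖y‖ ≤ 1 ∧ x = a * y * b := by
  let δ : ℕ → ℝ := fun n => 1 / ((n : ℝ) + 1)
  have δ_pos : ∀ n, 0 < δ n := fun n => Nat.one_div_pos_of_nat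
  have δ_tendsto : Tendsto δ atTop (𝓝 0) := tendsto_one_div_add_atTop_nhds_zero_nat
  let aδ : ℕ → H →L[ℂ] H := fun n => a + δ n • 1
  let bδ : ℕ → H →L[ℂ] H := fun n => b + δ n • 1
  have aδ_pos : ∀ n, IsStrictlyPositive (aδ n) := fun n =>
    isStrictlyPositive_add_smul_one ha0 (δ_pos n)
  have bδ_pos : ∀ n, IsStrictlyPositive (bδ n) := fun n =>
    isStrictlyPositive_add_smul_one hb0 (δ_pos n)
  let y : ℕ → H →L[ℂ] H := fun n => (aδ n)⁻¹ʳ * x * (bδ n)⁻¹ʳ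
  have y_mem : ∀ n, y n ∈ M := fun n =>
    mul_mem (mul_mem (ringInverse_mem (add_mem ha (NSFTrace.smul_mem' (one_mem M) (δ n)))) hx)
      (ringInverse_mem (add_mem hb (NSFTrace.smul_mem' (one_mem M) (δ n))))
  have y_le : ∀ n, ‖y n‖ ≤ 1 := fun n =>
    norm_ringInverse_mul_mul_ringInverse_le_one (aδ_pos n).isSelfAdjoint (aδ_pos n).isUnit
      (bδ_pos n).isUnit fun ξ η => (h ξ η).trans <| by
        gcongr
        exacts [norm_apply_le_norm_add_smul_one_apply ha0 (δ_pos n).le η,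
          norm_apply_le_norm_add_smul_one_apply hb0 (δ_pos n).le ξ]
  have eq_x : ∀ n, aδ n * y n * bδ n = x := fun n => by
    simp only [y, mul_assoc, Ring.inverse_mul_cancel _ (bδ_pos n).isUnit, mul_one,
      Ring.mul_inverse_cancel_left _ _ (aδ_pos n).isUnit]
  have norm_sub_le : ∀ n, ‖a * y n * b - x‖ ≤ δ n * (‖a‖ + ‖b‖ + δ n) := fun n => by
    nth_rw 1 [← eq_x n]
    exact norm_mul_mul_sub_add_smul_one_le (y_le n) (δ_pos n).le
  have y_tendsto : Tendsto (fun n => a * y n * b) atTop (𝓝 x) := by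
    refine tendsto_iff_norm_sub_tendsto_zero.2
      (squeeze_zero (fun _ => norm_nonneg _) norm_sub_le ?_)
    simpa using δ_tendsto.mul (δ_tendsto.const_add (‖a‖ + ‖b‖))
  obtain ⟨Y, hY, hlim⟩ := exists_isWeakLim_of_norm_le (hyperfilter ℕ) zero_le_one y_le
  exact ⟨Y, hlim.mem y_mem, hY, (isWeakLim_of_tendsto
    (y_tendsto.mono_left Nat.hyperfilter_le_atTop)).unique (hlim.mul_mul a b)⟩

theorem norm_mul_le_norm_mul_comm {u v : H →L[ℂ] H} (h : 0 ≤ u * v) : ‖u * v‖ ≤ ‖v * u‖ := by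
  rcases subsingleton_or_nontrivial H with _ | _
  · rw [Subsingleton.elim (u * v) (v * u)]
  · by_cases h0 : ‖u * v‖ = 0
    · exact h0.trans_le (norm_nonneg _)
    · have mem : ‖u * v‖ ∈ spectrum ℝ (u * v) \ {0} :=
        ⟨CStarAlgebra.norm_mem_spectrum_of_nonneg h, h0⟩
      rw [spectrum.nonzero_mul_comm] at mem
      simpa using spectrum.norm_le_norm_of_mem mem.1

theorem norm_sqrt_ringInverse_mul_mul_le_one (ha : IsStrictlyPositive a)
    (hb : IsStrictlyPositive b) (h1 : ∀ ζ, ‖star x ζ‖ ≤ ‖a ζ‖) (h2 : ∀ ζ, ‖x ζ‖ ≤ ‖b ζ‖) :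
    ‖(CFC.sqrt a)⁻¹ʳ * x * (CFC.sqrt b)⁻¹ʳ‖ ≤ 1 := by
  set p := (CFC.sqrt a)⁻¹ʳ
  set q := (CFC.sqrt b)⁻¹ʳ
  have sqrt_inv {c : H →L[ℂ] H} (hc : 0 ≤ c) :
      IsSelfAdjoint (CFC.sqrt c)⁻¹ʳ ∧ (CFC.sqrt c)⁻¹ʳ * (CFC.sqrt c)⁻¹ʳ = c⁻¹ʳ :=
    ⟨(CFC.sqrt_nonneg c).isSelfAdjoint.ringInverse, by
      rw [← Ring.mul_inverse_rev' (Commute.refl _), CFC.sqrt_mul_sqrt_self c hc]⟩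
  have mul_star : p * x * q * star (p * x * q) = p * (x * b⁻¹ʳ * star x * p) := by
    rw [← (sqrt_inv hb.nonneg).2]
    simp only [star_mul, (sqrt_inv ha.nonneg).1.star_eq, (sqrt_inv hb.nonneg).1.star_eq, p, q,
      mul_assoc]
  have sq_le : ‖p * x * q‖ * ‖p * x * q‖ ≤ 1 := calc
    _ = ‖p * (x * b⁻¹ʳ * star x * p)‖ := by rw [← CStarRing.norm_self_mul_star, mul_star]
    _ ≤ ‖x * b⁻¹ʳ * star x * p * p‖ :=
      norm_mul_le_norm_mul_comm (by rw [← mul_star]; exact mul_star_self_nonneg _)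
    _ = ‖x * b⁻¹ʳ * (star x * a⁻¹ʳ)‖ := by
      rw [← (sqrt_inv ha.nonneg).2]; simp only [p, mul_assoc]
    _ ≤ 1 := (norm_mul_le _ _).trans (mul_le_one₀ (norm_mul_ringInverse_le_one hb.isUnit h2)
      (norm_nonneg _) (norm_mul_ringInverse_le_one ha.isUnit h1))
  nlinarith [norm_nonneg (p * x * q)]

theorem norm_inner_le_of_isStrictlyPositive (ha : IsStrictlyPositive a)
    (hb : IsStrictlyPositive b) (h1 : ∀ ζ, ‖star x ζ‖ ≤ ‖a ζ‖) (h2 : ∀ ζ, ‖x ζ‖ ≤ ‖b ζ‖)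
    (ξ η : H) : ‖inner ℂ η (x ξ)‖ ≤ ‖CFC.sqrt a η‖ * ‖CFC.sqrt b ξ‖ := by
  have hx : CFC.sqrt a * ((CFC.sqrt a)⁻¹ʳ * x * (CFC.sqrt b)⁻¹ʳ) * CFC.sqrt b = x := by
    simp only [mul_assoc, Ring.inverse_mul_cancel _ hb.isUnit_cfcSqrt, mul_one,
      Ring.mul_inverse_cancel_left _ _ ha.isUnit_cfcSqrt]
  calc ‖inner ℂ η (x ξ)‖
      = ‖inner ℂ η ((CFC.sqrt a * ((CFC.sqrt a)⁻¹ʳ * x * (CFC.sqrt b)⁻¹ʳ) * CFC.sqrt b) ξ)‖ := by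
        rw [hx]
    _ ≤ _ := norm_inner_mul_mul_apply_le (CFC.sqrt_nonneg a).isSelfAdjoint
      (norm_sqrt_ringInverse_mul_mul_le_one ha hb h1 h2) ξ η

/-- The mixed Schwarz inequality. -/
theorem norm_inner_le_norm_sqrt_mul_norm_sqrt (ha : 0 ≤ a) (hb : 0 ≤ b)
    (h1 : x * star x ≤ a * a) (h2 : star x * x ≤ b * b) (ξ η : H) :
    ‖inner ℂ η (x ξ)‖ ≤ ‖CFC.sqrt a η‖ * ‖CFC.sqrt b ξ‖ := by
  have star_x_le : ∀ ζ, ‖star x ζ‖ ≤ ‖a ζ‖ := star_mul_self_le_iff.1 <| by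
    rwa [star_star, ha.isSelfAdjoint.star_eq]
  have x_le : ∀ ζ, ‖x ζ‖ ≤ ‖b ζ‖ := star_mul_self_le_iff.1 <| by
    rwa [hb.isSelfAdjoint.star_eq]
  have norm_sqrt_add {c : H →L[ℂ] H} (hc : 0 ≤ c) {δ : ℝ} (hδ : 0 < δ) (ζ : H) :
      ‖CFC.sqrt (c + δ • 1) ζ‖ ^ 2 = ‖CFC.sqrt c ζ‖ ^ 2 + δ * ‖ζ‖ ^ 2 := by
    rw [norm_sqrt_apply_sq (isStrictlyPositive_add_smul_one hc hδ).nonneg, norm_sqrt_apply_sq hc,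
      inner_add_smul_one_apply_re]
  let bound : ℝ → ℝ := fun δ =>
    (‖CFC.sqrt a η‖ ^ 2 + δ * ‖η‖ ^ 2) * (‖CFC.sqrt b ξ‖ ^ 2 + δ * ‖ξ‖ ^ 2)
  have sq_le : ∀ δ > 0, ‖inner ℂ η (x ξ)‖ ^ 2 ≤ bound δ := fun δ hδ => by
    simp only [bound, ← norm_sqrt_add ha hδ, ← norm_sqrt_add hb hδ, ← mul_pow]
    gcongr
    exact norm_inner_le_of_isStrictlyPositive (isStrictlyPositive_add_smul_one ha hδ)
      (isStrictlyPositive_add_smul_one hb hδ)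
      (fun ζ => (star_x_le ζ).trans (norm_apply_le_norm_add_smul_one_apply ha hδ.le ζ))
      (fun ζ => (x_le ζ).trans (norm_apply_le_norm_add_smul_one_apply hb hδ.le ζ)) ξ η
  have bound_tendsto : Tendsto bound (𝓝[>] 0) (𝓝 (bound 0)) :=
    (show Continuous bound by fun_prop).continuousWithinAt
  refine le_of_sq_le_sq ?_ (by positivity)
  calc ‖inner ℂ η (x ξ)‖ ^ 2 ≤ bound 0 :=
        ge_of_tendsto bound_tendsto (eventually_nhdsWithin_of_forall sq_le)
    _ = (‖CFC.sqrt a η‖ * ‖CFC.sqrt b ξ‖) ^ 2 := by simp [bound, mul_pow]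

end Factorization

section Damp

variable {H : Type*} [NormedAddCommGroup H] [InnerProductSpace ℂ H] [CompleteSpace H]
  {s t : H →L[ℂ] H}

/-- The bounded transform `s (1 + s)⁻¹` of a positive operator `s`, written so that its operator
monotonicity is visible. -/
noncomputable def damp (s : H →L[ℂ] H) : H →L[ℂ] H := cfc (fun t : ℝ => 1 - (1 + t)⁻¹) s

theorem one_sub_one_add_inv {t : ℝ} (ht : 0 ≤ t) : 1 - (1 + t)⁻¹ = t / (1 + t) := by
  field_simp
  ring

theorem continuousOn_one_sub_one_add_inv :
    ContinuousOn (fun t : ℝ => 1 - (1 + t)⁻¹) (Set.Ici 0) :=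
  continuousOn_const.sub <| ContinuousOn.inv₀ (by fun_prop) fun t (ht : 0 ≤ t) => by positivity

theorem continuousOn_damp (hs : 0 ≤ s) :
    ContinuousOn (fun t : ℝ => 1 - (1 + t)⁻¹) (spectrum ℝ s) :=
  continuousOn_one_sub_one_add_inv.mono (spectrum_nonneg_of_nonneg hs)

theorem damp_eq_cfcₙ (hs : 0 ≤ s) : damp s = cfcₙ (fun t : ℝ => 1 - (1 + t)⁻¹) s :=
  (cfcₙ_eq_cfc (hf := continuousOn_one_sub_one_add_inv.mono
    (quasispectrum_nonneg_of_nonneg s hs)) (hf0 := by simp)).symm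

theorem damp_mono (hs : 0 ≤ s) (h : s ≤ t) : damp s ≤ damp t := by
  rw [damp_eq_cfcₙ hs, damp_eq_cfcₙ (hs.trans h)]
  exact CFC.monotoneOn_one_sub_one_add_inv_real hs (hs.trans h) h

theorem damp_nonneg (hs : 0 ≤ s) : 0 ≤ damp s := by
  refine cfc_nonneg fun t ht => ?_
  have ht0 := spectrum_nonneg_of_nonneg hs ht
  rw [one_sub_one_add_inv ht0]
  positivity

theorem damp_le_self (hs : 0 ≤ s) : damp s ≤ s := by
  conv_rhs => rw [← cfc_id' ℝ s hs.isSelfAdjoint]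
  refine cfc_mono (fun t ht => ?_) (continuousOn_damp hs) (by fun_prop)
  have ht0 := spectrum_nonneg_of_nonneg hs ht
  rw [one_sub_one_add_inv ht0]
  exact div_le_self ht0 (by linarith)

theorem norm_damp_le_one (hs : 0 ≤ s) : ‖damp s‖ ≤ 1 := by
  refine norm_cfc_le zero_le_one fun t ht => ?_
  have ht0 := spectrum_nonneg_of_nonneg hs ht
  rw [one_sub_one_add_inv ht0, Real.norm_of_nonneg (by positivity)]
  exact (div_le_one (by positivity)).2 (by linarith)

theorem le_smul_damp (hs : 0 ≤ s) {c : ℝ≥0} (hc : ‖s‖ ≤ c) : s ≤ (1 + c) • damp s := by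
  rw [NNReal.smul_def, damp, ← cfc_smul _ _ _ (continuousOn_damp hs)]
  conv_lhs => rw [← cfc_id' ℝ s hs.isSelfAdjoint]
  have continuousOn_smul := (continuousOn_damp hs).const_smul ((1 + c : ℝ≥0) : ℝ)
  refine cfc_mono (fun t ht => ?_) (by fun_prop) continuousOn_smul
  have ht0 := spectrum_nonneg_of_nonneg hs ht
  have ht_le : t ≤ c := (Real.le_norm_self t).trans ((spectrum.norm_le_norm_mul_of_mem ht).trans
    ((mul_le_of_le_one_right (norm_nonneg s) ContinuousLinearMap.norm_id_le).trans hc))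
  rw [one_sub_one_add_inv ht0, smul_eq_mul, mul_div_assoc', le_div_iff₀ (by positivity), mul_comm]
  push_cast
  gcongr

theorem damp_mem {M : VonNeumannAlgebra H} (hs : s ∈ M) : damp s ∈ M :=
  mem_of_forall_commute fun _ hg => (hg s hs).cfc_real _

end Damp

/-! ### Hölder's inequality for a trace -/

namespace NSFTrace

variable {H : Type*} [NormedAddCommGroup H] [InnerProductSpace ℂ H] [CompleteSpace H]
  {M : VonNeumannAlgebra H} (τ : NSFTrace M)

section Pairing

variable {P Q R g y : H →L[ℂ] H}

theorem toFun_smul (c : ℝ≥0) (hP : P ∈ M) (hP0 : 0 ≤ P) : τ.toFun (c • P) = c * τ.toFun P :=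
  τ.map_smul c P hP hP0

theorem toFun_sum {ι : Type*} (F : Finset ι) {h : ι → H →L[ℂ] H} (hM : ∀ i, h i ∈ M)
    (h0 : ∀ i, 0 ≤ h i) : τ.toFun (∑ i ∈ F, h i) = ∑ i ∈ F, τ.toFun (h i) := by
  classical
  induction F using Finset.induction_on with
  | empty => simpa using τ.map_smul 0 0 (zero_mem M) le_rfl
  | insert i F hi ih =>
    rw [Finset.sum_insert hi, Finset.sum_insert hi, τ.map_add _ (hM i) _
      (sum_mem fun j _ => hM j) (h0 i) (Finset.sum_nonneg fun j _ => h0 j), ih]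

theorem sqrt_mul_mul_sqrt_mem (hP : P ∈ M) (hQ : Q ∈ M) : CFC.sqrt P * Q * CFC.sqrt P ∈ M :=
  mul_mem (mul_mem (sqrt_mem hP) hQ) (sqrt_mem hP)

theorem sqrt_mul_mul_sqrt (hP : 0 ≤ P) : CFC.sqrt P * P * CFC.sqrt P = P * P := by
  have sqrt_mul_sqrt := CFC.sqrt_mul_sqrt_self P hP
  calc CFC.sqrt P * P * CFC.sqrt P
      = CFC.sqrt P * (CFC.sqrt P * CFC.sqrt P) * CFC.sqrt P := by rw [sqrt_mul_sqrt]
    _ = (CFC.sqrt P * CFC.sqrt P) * (CFC.sqrt P * CFC.sqrt P) := by simp only [mul_assoc]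
    _ = P * P := by rw [sqrt_mul_sqrt]

/-- The number `τ(PQ) ∈ [0, ∞]` for positive `P, Q ∈ M`.  Since `PQ` need not be positive, it is
encoded as `τ(√P Q √P)`. -/
noncomputable def pairing (P Q : H →L[ℂ] H) : ℝ≥0∞ := τ.toFun (CFC.sqrt P * Q * CFC.sqrt P)

theorem pairing_self (hP : 0 ≤ P) : τ.pairing P P = τ.toFun (P * P) := by
  rw [pairing, sqrt_mul_mul_sqrt hP]

theorem toFun_star_mul_mul (hg : g ∈ M) (hP : P ∈ M) (hP0 : 0 ≤ P) :
    τ.toFun (star g * P * g) = τ.pairing P (g * star g) := by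
  have tracial := τ.tracial (CFC.sqrt P * g) (mul_mem (sqrt_mem hP) hg)
  rw [star_mul, (CFC.sqrt_nonneg P).isSelfAdjoint.star_eq] at tracial
  calc τ.toFun (star g * P * g)
      = τ.toFun (star g * CFC.sqrt P * (CFC.sqrt P * g)) := by
        nth_rw 1 [← CFC.sqrt_mul_sqrt_self P hP0]
        simp only [mul_assoc]
    _ = τ.pairing P (g * star g) := by
        rw [tracial, pairing]
        simp only [mul_assoc]

theorem pairing_comm (hP : P ∈ M) (hQ : Q ∈ M) (hP0 : 0 ≤ P) (hQ0 : 0 ≤ Q) :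
    τ.pairing P Q = τ.pairing Q P := by
  have h := τ.toFun_star_mul_mul (sqrt_mem hQ) hP hP0
  rw [(CFC.sqrt_nonneg Q).isSelfAdjoint.star_eq, CFC.sqrt_mul_sqrt_self Q hQ0] at h
  exact h.symm

theorem pairing_add_right (hP : P ∈ M) (hQ : Q ∈ M) (hR : R ∈ M) (hQ0 : 0 ≤ Q) (hR0 : 0 ≤ R) :
    τ.pairing P (Q + R) = τ.pairing P Q + τ.pairing P R := by
  have hs := CFC.sqrt_nonneg P
  rw [pairing, mul_add, add_mul]
  exact τ.map_add _ (sqrt_mul_mul_sqrt_mem hP hQ) _ (sqrt_mul_mul_sqrt_mem hP hR)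
    (conjugate_nonneg_of_nonneg hQ0 hs) (conjugate_nonneg_of_nonneg hR0 hs)

theorem pairing_mono_right (hP : P ∈ M) (hQ : Q ∈ M) (hR : R ∈ M) (hQ0 : 0 ≤ Q) (h : Q ≤ R) :
    τ.pairing P Q ≤ τ.pairing P R :=
  τ.mono (sqrt_mul_mul_sqrt_mem hP hQ) (sqrt_mul_mul_sqrt_mem hP hR)
    (conjugate_nonneg_of_nonneg hQ0 (CFC.sqrt_nonneg P))
    (conjugate_le_conjugate_of_nonneg h (CFC.sqrt_nonneg P))

theorem toFun_add_mul_self (hP : P ∈ M) (hQ : Q ∈ M) (hP0 : 0 ≤ P) (hQ0 : 0 ≤ Q) :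
    τ.toFun ((P + Q) * (P + Q)) = τ.toFun (P * P) + τ.toFun (Q * Q) + 2 * τ.pairing P Q := by
  have hPQ := add_mem hP hQ
  have hPQ0 := add_nonneg hP0 hQ0
  rw [← τ.pairing_self hPQ0, τ.pairing_add_right hPQ hP hQ hP0 hQ0,
    τ.pairing_comm hPQ hP hPQ0 hP0, τ.pairing_comm hPQ hQ hPQ0 hQ0,
    τ.pairing_add_right hP hP hQ hP0 hQ0, τ.pairing_add_right hQ hP hQ hP0 hQ0,
    τ.pairing_comm hQ hP hQ0 hP0, τ.pairing_self hP0, τ.pairing_self hQ0]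
  ring

theorem mul_star_self_le_one (hy : ‖y‖ ≤ 1) : y * star y ≤ 1 := by
  refine (CStarAlgebra.norm_le_one_iff_of_nonneg _ (mul_star_self_nonneg y)).1 ?_
  rw [CStarRing.norm_self_mul_star]
  exact mul_le_one₀ hy (norm_nonneg y) hy

theorem toFun_star_mul_mul_le (hy : y ∈ M) (hy1 : ‖y‖ ≤ 1) (hP : P ∈ M) (hP0 : 0 ≤ P) :
    τ.toFun (star y * P * y) ≤ τ.toFun P := by
  rw [τ.toFun_star_mul_mul hy hP hP0]
  refine (τ.pairing_mono_right hP (mul_mem hy (star_mem hy)) (one_mem M) (mul_star_self_nonneg y)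
    (mul_star_self_le_one hy1)).trans_eq ?_
  rw [pairing, mul_one, CFC.sqrt_mul_sqrt_self P hP0]

theorem toFun_star_mul_mul_sq_le (hy : y ∈ M) (hy1 : ‖y‖ ≤ 1) (hP : P ∈ M) (hP0 : 0 ≤ P) :
    τ.toFun (star y * P * y * (star y * P * y)) ≤ τ.toFun (P * P) := by
  have hyy := mul_mem hy (star_mem hy)
  have conj_le := conjugate_le_conjugate_of_nonneg (mul_star_self_le_one hy1) hP0
  rw [mul_one] at conj_le
  have conj_nonneg := conjugate_nonneg_of_nonneg (mul_star_self_nonneg y) hP0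
  have conj_mem := mul_mem (mul_mem hP hyy) hP
  calc τ.toFun (star y * P * y * (star y * P * y))
      = τ.toFun (star y * (P * (y * star y) * P) * y) := by simp only [mul_assoc]
    _ ≤ τ.toFun (P * (y * star y) * P) := τ.toFun_star_mul_mul_le hy hy1 conj_mem conj_nonneg
    _ ≤ τ.toFun (P * P) := τ.mono conj_mem (mul_mem hP hP) conj_nonneg conj_le

theorem toFun_fourth_le_pairing_cube (hP : P ∈ M) (hQ : Q ∈ M) (hP0 : 0 ≤ P) (h : P ≤ Q) :
    τ.toFun (P * P * (P * P)) ≤ τ.pairing P (Q * Q * Q) := by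
  have hQ0 := hP0.trans h
  have square_le : P * P ≤ CFC.sqrt P * Q * CFC.sqrt P := by
    rw [← sqrt_mul_mul_sqrt hP0]
    exact conjugate_le_conjugate_of_nonneg h (CFC.sqrt_nonneg P)
  calc τ.toFun (P * P * (P * P))
      ≤ τ.toFun (CFC.sqrt P * Q * CFC.sqrt P * (CFC.sqrt P * Q * CFC.sqrt P)) :=
        τ.sq_mono (mul_mem hP hP) (sqrt_mul_mul_sqrt_mem hP hQ)
          hP0.isSelfAdjoint.mul_self_nonneg square_le
    _ = τ.toFun (CFC.sqrt P * (Q * (CFC.sqrt P * CFC.sqrt P) * Q) * CFC.sqrt P) := by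
        simp only [mul_assoc]
    _ = τ.pairing P (Q * P * Q) := by rw [CFC.sqrt_mul_sqrt_self P hP0, pairing]
    _ ≤ τ.pairing P (Q * Q * Q) :=
        τ.pairing_mono_right hP (mul_mem (mul_mem hQ hP) hQ) (mul_mem (mul_mem hQ hQ) hQ)
          (conjugate_nonneg_of_nonneg hP0 hQ0) (conjugate_le_conjugate_of_nonneg h hQ0)

theorem toFun_fourth_superadd (hP : P ∈ M) (hQ : Q ∈ M) (hP0 : 0 ≤ P) (hQ0 : 0 ≤ Q) :
    τ.toFun (P * P * (P * P)) + τ.toFun (Q * Q * (Q * Q)) ≤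
      τ.toFun ((P + Q) * (P + Q) * ((P + Q) * (P + Q))) := by
  set R := P + Q with hR_def
  have hR : R ∈ M := add_mem hP hQ
  have hR0 : 0 ≤ R := add_nonneg hP0 hQ0
  have cube_mem : R * R * R ∈ M := mul_mem (mul_mem hR hR) hR
  have cube_nonneg : 0 ≤ R * R * R := conjugate_nonneg_of_nonneg hR0 hR0
  have fourth_eq : τ.toFun (R * R * (R * R)) = τ.pairing R (R * R * R) := by
    have sqrt_mul_sqrt := CFC.sqrt_mul_sqrt_self R hR0
    have comm : Commute (CFC.sqrt R) R := by
      nth_rw 2 [← sqrt_mul_sqrt]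
      exact (Commute.refl _).mul_right (Commute.refl _)
    rw [pairing, ((comm.mul_right comm).mul_right comm).eq, mul_assoc (R * R * R), sqrt_mul_sqrt,
      mul_assoc (R * R)]
  rw [fourth_eq, τ.pairing_comm hR cube_mem hR0 cube_nonneg, hR_def,
    τ.pairing_add_right cube_mem hP hQ hP0 hQ0, τ.pairing_comm cube_mem hP cube_nonneg hP0,
    τ.pairing_comm cube_mem hQ cube_nonneg hQ0]
  exact add_le_add (τ.toFun_fourth_le_pairing_cube hP hR hP0 (le_add_of_nonneg_right hQ0))
    (τ.toFun_fourth_le_pairing_cube hQ hR hQ0 (le_add_of_nonneg_left hP0))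

end Pairing

variable {τ}

theorem PreL2.enorm_sq (x : τ.PreL2) : ‖x‖ₑ ^ 2 = τ.toFun (star x.op * x.op) := by
  rw [← ofReal_norm, ← ENNReal.ofReal_pow (norm_nonneg x)]
  exact (congrArg _ (τ.nrm2_sq x.op)).trans (ENNReal.ofReal_toReal x.2.2.ne)

theorem PreL2.enorm_sq_of_nonneg {x : τ.PreL2} (hx : 0 ≤ x.op) :
    ‖x‖ₑ ^ 2 = τ.toFun (x.op * x.op) := by
  rw [enorm_sq, hx.isSelfAdjoint.star_eq]

theorem PreL4.enorm_pow_four (u : τ.PreL4) :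
    ‖u‖ₑ ^ 4 = τ.toFun (star u.op * u.op * (star u.op * u.op)) := by
  have nrm4_pow_four : ‖u‖ ^ 4 = (τ.toFun ((star u.op * u.op) ^ 2)).toReal := by
    calc ‖u‖ ^ 4 = (τ.nrm4 u.op ^ 2) ^ 2 := (pow_mul (τ.nrm4 u.op) 2 2)
      _ = (τ.toFun ((star u.op * u.op) ^ 2)).toReal := by rw [nrm4_sq, nrm2_sq, star_sq]
  rw [← ofReal_norm, ← ENNReal.ofReal_pow (norm_nonneg u), nrm4_pow_four, ← sq]
  exact ENNReal.ofReal_toReal u.2.2.ne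

theorem PreL4.enorm_pow_four_of_nonneg {u : τ.PreL4} (hu : 0 ≤ u.op) :
    ‖u‖ₑ ^ 4 = τ.toFun (u.op * u.op * (u.op * u.op)) := by
  rw [enorm_pow_four, hu.isSelfAdjoint.star_eq]

theorem PreL4.norm_sub_pow_four_le {u v : τ.PreL4} (hu : 0 ≤ u.op) (h : u.op ≤ v.op) :
    ‖v - u‖ ^ 4 ≤ ‖v‖ ^ 4 - ‖u‖ ^ 4 := by
  have h_sub : 0 ≤ (v - u).op := sub_nonneg.2 h
  have superadd := τ.toFun_fourth_superadd u.2.1 (v - u).2.1 hu h_sub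
  rw [show u.1 + (v - u).1 = v.op from add_sub_cancel u.op v.op] at superadd
  change τ.toFun (u.op * u.op * (u.op * u.op)) +
    τ.toFun ((v - u).op * (v - u).op * ((v - u).op * (v - u).op)) ≤ _ at superadd
  rw [← enorm_pow_four_of_nonneg hu, ← enorm_pow_four_of_nonneg h_sub,
    ← enorm_pow_four_of_nonneg (hu.trans h)] at superadd
  simp only [← ofReal_norm, ← ENNReal.ofReal_pow (norm_nonneg _)] at superadd
  rw [← ENNReal.ofReal_add (by positivity) (by positivity),
    ENNReal.ofReal_le_ofReal_iff (by positivity)] at superadd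
  linarith

theorem PreL2.pairing_le_enorm_mul_enorm {P Q : τ.PreL2} (hP : 0 ≤ P.op) (hQ : 0 ≤ Q.op) :
    τ.pairing P.op Q.op ≤ ‖P‖ₑ * ‖Q‖ₑ := by
  have expand : ‖P + Q‖ₑ ^ 2 = ‖P‖ₑ ^ 2 + ‖Q‖ₑ ^ 2 + 2 * τ.pairing P.op Q.op := by
    rw [enorm_sq_of_nonneg hP, enorm_sq_of_nonneg hQ, enorm_sq_of_nonneg (add_nonneg hP hQ)]
    exact τ.toFun_add_mul_self P.2.1 Q.2.1 hP hQ
  have triangle : ‖P + Q‖ₑ ^ 2 ≤ ‖P‖ₑ ^ 2 + ‖Q‖ₑ ^ 2 + 2 * (‖P‖ₑ * ‖Q‖ₑ) := by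
    calc ‖P + Q‖ₑ ^ 2 ≤ (‖P‖ₑ + ‖Q‖ₑ) ^ 2 := by
          gcongr
          simp only [← ofReal_norm, ← ENNReal.ofReal_add (norm_nonneg _) (norm_nonneg _)]
          exact ENNReal.ofReal_le_ofReal (norm_add_le P Q)
      _ = ‖P‖ₑ ^ 2 + ‖Q‖ₑ ^ 2 + 2 * (‖P‖ₑ * ‖Q‖ₑ) := by ring
  rw [expand] at triangle
  exact (ENNReal.mul_le_mul_iff_right two_ne_zero ENNReal.ofNat_ne_top).1
    ((ENNReal.add_le_add_iff_left (by finiteness)).1 triangle)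

namespace PreL4

theorem exists_op_eq_star_mul_mul (u : τ.PreL4) {y : H →L[ℂ] H} (hy : y ∈ M) (hy1 : ‖y‖ ≤ 1) :
    ∃ P : τ.PreL2, P.op = star y * (star u.op * u.op) * y ∧ ‖P‖ₑ ≤ ‖u‖ₑ ^ 2 := by
  have hX : star u.op * u.op ∈ M := star_mul_mem u.2.1
  have hX0 : 0 ≤ star u.op * u.op := star_mul_self_nonneg u.op
  have hP0 : 0 ≤ star y * (star u.op * u.op) * y := star_left_conjugate_nonneg hX0 y
  have toFun_le := τ.toFun_star_mul_mul_sq_le hy hy1 hX hX0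
  rw [← u.enorm_pow_four] at toFun_le
  nth_rw 1 [← hP0.isSelfAdjoint.star_eq] at toFun_le
  let P : τ.PreL2 := ⟨star y * (star u.op * u.op) * y, mul_mem (mul_mem (star_mem hy) hX) hy,
    toFun_le.trans_lt (by finiteness)⟩
  refine ⟨P, rfl, (ENNReal.pow_le_pow_left_iff two_ne_zero).1 ?_⟩
  rw [← pow_mul]
  exact P.enorm_sq.trans_le toFun_le

theorem exists_op_eq_mul_star (v : τ.PreL4) :
    ∃ Q : τ.PreL2, Q.op = v.op * star v.op ∧ ‖Q‖ₑ ≤ ‖v‖ₑ ^ 2 := by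
  have hQ0 : 0 ≤ v.op * star v.op := mul_star_self_nonneg v.op
  have toFun_eq : τ.toFun (star (v.op * star v.op) * (v.op * star v.op)) = ‖v‖ₑ ^ 4 := by
    have h := τ.toFun_star_mul_mul (star_mem v.2.1) (star_mul_mem v.2.1) (star_mul_self_nonneg v.op)
    rw [star_star] at h
    rw [v.enorm_pow_four, ← τ.pairing_self (star_mul_self_nonneg v.op), hQ0.isSelfAdjoint.star_eq]
    refine Eq.trans ?_ h
    simp only [mul_assoc, PreL4.op]
  let Q : τ.PreL2 := ⟨v.op * star v.op, mul_mem v.2.1 (star_mem v.2.1),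
    toFun_eq.trans_lt (by finiteness)⟩
  refine ⟨Q, rfl, (ENNReal.pow_le_pow_left_iff two_ne_zero).1 ?_⟩
  rw [← pow_mul]
  exact (Q.enorm_sq.trans toFun_eq).le

theorem exists_op_eq_mul_mul (u v : τ.PreL4) {y : H →L[ℂ] H} (hy : y ∈ M) (hy1 : ‖y‖ ≤ 1) :
    ∃ x : τ.PreL2, x.op = u.op * y * v.op ∧ ‖x‖ ≤ ‖u‖ * ‖v‖ := by
  obtain ⟨P, hP, norm_P⟩ := u.exists_op_eq_star_mul_mul hy hy1
  obtain ⟨Q, hQ, norm_Q⟩ := v.exists_op_eq_mul_star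
  have hP0 : 0 ≤ P.op := hP ▸ star_left_conjugate_nonneg (star_mul_self_nonneg u.op) y
  have hQ0 : 0 ≤ Q.op := hQ ▸ mul_star_self_nonneg v.op
  have star_mul_self_eq : star (u.op * y * v.op) * (u.op * y * v.op) = star v.op * P.op * v.op := by
    rw [hP]
    simp only [star_mul, mul_assoc]
  have toFun_le : τ.toFun (star (u.op * y * v.op) * (u.op * y * v.op)) ≤ (‖u‖ₑ * ‖v‖ₑ) ^ 2 := by
    have pairing_le := PreL2.pairing_le_enorm_mul_enorm hP0 hQ0
    rw [hQ] at pairing_le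
    rw [star_mul_self_eq, mul_pow]
    exact (τ.toFun_star_mul_mul v.2.1 P.2.1 hP0).trans_le
      (pairing_le.trans (mul_le_mul' norm_P norm_Q))
  let x : τ.PreL2 := ⟨u.op * y * v.op, mul_mem (mul_mem u.2.1 hy) v.2.1,
    toFun_le.trans_lt (by finiteness)⟩
  have enorm_le : ‖x‖ₑ ≤ ‖u‖ₑ * ‖v‖ₑ :=
    (ENNReal.pow_le_pow_left_iff two_ne_zero).1 (x.enorm_sq.trans_le toFun_le)
  rw [← ofReal_norm, ← ofReal_norm, ← ofReal_norm, ← ENNReal.ofReal_mul (norm_nonneg u)] at enorm_le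
  exact ⟨x, rfl, (ENNReal.ofReal_le_ofReal_iff (by positivity)).1 enorm_le⟩

end PreL4

end NSFTrace

/-! ### Weak operator limits in `L_2(M)` -/

theorem mem_closure_of_tendsto_dual {ι E : Type*} [NormedAddCommGroup E] [NormedSpace ℂ E]
    {U : Filter ι} [U.NeBot] {K : Set E} (hK : Convex ℝ K) {z : ι → E} {ζ : E}
    (hz : ∀ᶠ k in U, z k ∈ K) (h : ∀ f : StrongDual ℂ E, Tendsto (fun k => f (z k)) U (𝓝 (f ζ))) :
    ζ ∈ closure K := by
  by_contra hn
  obtain ⟨f, u, hu, hu'⟩ := RCLike.geometric_hahn_banach_closed_point (𝕜 := ℂ) hK.closure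
    isClosed_closure hn
  exact hu'.not_ge (le_of_tendsto ((Complex.continuous_re.tendsto _).comp (h f))
    (hz.mono fun k hk => (hu _ (subset_closure hk)).le))

theorem tsum_two_pow_mul_sq_le {a : ℕ → ℝ≥0∞} (ha : ∀ i, a i ≤ 2⁻¹ ^ i) (N : ℕ) :
    ∑' j, 2 ^ (j + 1) * a (N + j) ^ 2 ≤ 4 * (2⁻¹ ^ N) ^ 2 := calc
  _ ≤ ∑' j : ℕ, 2 * (2⁻¹ ^ N) ^ 2 * (2⁻¹ : ℝ≥0∞) ^ j := by
    refine ENNReal.tsum_le_tsum fun j => ?_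
    have cancel : (2 : ℝ≥0∞) ^ j * 2⁻¹ ^ j = 1 := by
      rw [← mul_pow, ENNReal.mul_inv_cancel two_ne_zero ENNReal.ofNat_ne_top, one_pow]
    calc (2 : ℝ≥0∞) ^ (j + 1) * a (N + j) ^ 2 ≤ 2 ^ (j + 1) * (2⁻¹ ^ (N + j)) ^ 2 := by
          gcongr; exact ha (N + j)
      _ = 2 * (2⁻¹ ^ N) ^ 2 * 2⁻¹ ^ j * (2 ^ j * 2⁻¹ ^ j) := by ring
      _ = 2 * (2⁻¹ ^ N) ^ 2 * 2⁻¹ ^ j := by rw [cancel, mul_one]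
  _ = 4 * (2⁻¹ ^ N) ^ 2 := by
    rw [ENNReal.tsum_mul_left, ENNReal.tsum_geometric, ENNReal.one_sub_inv_two, inv_inv]
    ring

namespace NSFTrace

variable {H : Type*} [NormedAddCommGroup H] [InnerProductSpace ℂ H] [CompleteSpace H]
  {M : VonNeumannAlgebra H} {τ : NSFTrace M}

theorem exists_forall_damp_le {s : ℕ → H →L[ℂ] H} (hM : ∀ K, s K ∈ M) (h0 : ∀ K, 0 ≤ s K)
    (hs : Monotone s) {B : ℝ≥0∞} (hB : ∀ K, τ.toFun (s K) ≤ B) :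
    ∃ q ∈ M, 0 ≤ q ∧ τ.toFun q ≤ B ∧ ∀ K, damp (s K) ≤ q := by
  have damp_monotone : Monotone fun K => damp (s K) := fun K L hKL => damp_mono (h0 K) (hs hKL)
  obtain ⟨q, -, hq⟩ := exists_isWeakLim_of_norm_le (hyperfilter ℕ) zero_le_one
    fun K => norm_damp_le_one (h0 K)
  have isLUB := hq.isLUB Nat.hyperfilter_le_atTop damp_monotone
  have q_mem : q ∈ M := hq.mem fun K => damp_mem (hM K)
  refine ⟨q, q_mem, hq.nonneg (.of_forall fun K => damp_nonneg (h0 K)), ?_,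
    fun K => isLUB.1 ⟨K, rfl⟩⟩
  rw [τ.normal _ (Set.range_nonempty _) damp_monotone.directed_le.directedOn_range
    (Set.forall_mem_range.2 fun K => ⟨damp_mem (hM K), damp_nonneg (h0 K)⟩) q q_mem isLUB,
    iSup_range]
  exact iSup_le fun K =>
    (τ.mono (damp_mem (hM K)) (hM K) (damp_nonneg (h0 K)) (damp_le_self (h0 K))).trans (hB K)

theorem star_sub_mul_sub_le_sum (w : ℕ → H →L[ℂ] H) (K : ℕ) :
    star (w 0 - w K) * (w 0 - w K) ≤ ∑ j ∈ Finset.range K,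
      (2 : ℝ≥0) ^ (j + 1) • (star (w j - w (j + 1)) * (w j - w (j + 1))) := by
  induction K generalizing w with
  | zero => simp
  | succ K ih =>
    have add_sq_le := add_sq_le (w 0 - w 1) (w 1 - w (K + 1)) one_pos
    rw [sub_add_sub_cancel, inv_one, one_add_one_eq_two] at add_sq_le
    change _ ≤ (2 : ℝ≥0) • (star (w 0 - w 1) * (w 0 - w 1)) +
      (2 : ℝ≥0) • (star (w 1 - w (K + 1)) * (w 1 - w (K + 1))) at add_sq_le
    have ih_shift := smul_le_smul_of_nonneg_left (ih fun j => w (j + 1)) (zero_le (a := (2 : ℝ≥0)))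
    rw [Finset.smul_sum] at ih_shift
    simp only [smul_smul, ← pow_succ'] at ih_shift
    rw [Finset.sum_range_succ', zero_add, pow_one]
    exact (add_sq_le.trans (add_le_add_right ih_shift _)).trans_eq (add_comm _ _)

theorem exists_forall_damp_sum_smul_le (c : ℕ → ℝ≥0) {d : ℕ → H →L[ℂ] H} (hM : ∀ j, d j ∈ M)
    (h0 : ∀ j, 0 ≤ d j) :
    ∃ q ∈ M, 0 ≤ q ∧ τ.toFun q ≤ ∑' j, c j * τ.toFun (d j) ∧
      ∀ K, damp (∑ j ∈ Finset.range K, c j • d j) ≤ q := by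
  have smul_mem (j : ℕ) : c j • d j ∈ M := smul_mem' (hM j) (c j)
  have smul_nonneg (j : ℕ) : 0 ≤ c j • d j := smul_nonneg zero_le (h0 j)
  refine exists_forall_damp_le (fun _ => sum_mem fun j _ => smul_mem j)
    (fun _ => Finset.sum_nonneg fun j _ => smul_nonneg j)
    (fun _ _ hKL => Finset.sum_le_sum_of_subset_of_nonneg (Finset.range_mono hKL)
      fun j _ _ => smul_nonneg j) fun _ => ?_
  rw [τ.toFun_sum _ smul_mem smul_nonneg]
  exact (Finset.sum_le_sum fun j _ => (τ.toFun_smul _ (hM j) (h0 j)).le).trans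
    (ENNReal.sum_le_tsum _)

theorem exists_forall_star_sub_mul_sub_le {w : ℕ → H →L[ℂ] H} {C : ℝ≥0} (hw : ∀ i, w i ∈ M)
    (hC : ∀ i, ‖w i‖ ≤ C) :
    ∃ q ∈ M, 0 ≤ q ∧ τ.toFun q ≤ ∑' j, 2 ^ (j + 1) *
        τ.toFun (star (w j - w (j + 1)) * (w j - w (j + 1))) ∧
      ∀ K, star (w 0 - w K) * (w 0 - w K) ≤ (1 + (2 * C) ^ 2 : ℝ≥0) • q := by
  have diff_mem (j : ℕ) : star (w j - w (j + 1)) * (w j - w (j + 1)) ∈ M :=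
    star_mul_mem (sub_mem (hw j) (hw (j + 1)))
  have diff_nonneg (j : ℕ) : 0 ≤ star (w j - w (j + 1)) * (w j - w (j + 1)) :=
    star_mul_self_nonneg _
  obtain ⟨q, q_mem, q_nonneg, toFun_q_le, hq⟩ := exists_forall_damp_sum_smul_le (τ := τ)
    (fun j => 2 ^ (j + 1)) diff_mem diff_nonneg
  simp only [ENNReal.coe_pow, ENNReal.coe_ofNat] at toFun_q_le
  refine ⟨q, q_mem, q_nonneg, toFun_q_le, fun K => ?_⟩
  have sq_nonneg : 0 ≤ star (w 0 - w K) * (w 0 - w K) := star_mul_self_nonneg _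
  have norm_le : ‖star (w 0 - w K) * (w 0 - w K)‖ ≤ ((2 * C) ^ 2 : ℝ≥0) := by
    rw [CStarRing.norm_star_mul_self, ← sq]
    push_cast
    gcongr
    exact (norm_sub_le _ _).trans (by linarith [hC 0, hC K])
  calc star (w 0 - w K) * (w 0 - w K)
      ≤ (1 + (2 * C) ^ 2 : ℝ≥0) • damp (star (w 0 - w K) * (w 0 - w K)) :=
        le_smul_damp sq_nonneg norm_le
    _ ≤ (1 + (2 * C) ^ 2 : ℝ≥0) • q := by
        gcongr
        exact (damp_mono sq_nonneg (star_sub_mul_sub_le_sum w K)).trans (hq K)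

theorem toFun_star_sub_mul_sub_isWeakLim_le {U : Filter ℕ} [U.NeBot] (hU : U ≤ atTop)
    {w : ℕ → H →L[ℂ] H} {Y : H →L[ℂ] H} {C : ℝ≥0} (hw : ∀ i, w i ∈ M) (hC : ∀ i, ‖w i‖ ≤ C)
    (hY : IsWeakLim U w Y) (N : ℕ) :
    τ.toFun (star (w N - Y) * (w N - Y)) ≤ (1 + (2 * C) ^ 2 : ℝ≥0) *
      ∑' j, 2 ^ (j + 1) *
        τ.toFun (star (w (N + j) - w (N + j + 1)) * (w (N + j) - w (N + j + 1))) := by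
  obtain ⟨q, q_mem, q_nonneg, toFun_q_le, hq⟩ :=
    exists_forall_star_sub_mul_sub_le (τ := τ) (fun i => hw (N + i)) fun i => hC (N + i)
  have sub_isWeakLim := (isWeakLim_of_tendsto (tendsto_const_nhds (x := w N))).sub hY
  have limit_le := sub_isWeakLim.star_mul_self_le <| hU <| by
    filter_upwards [eventually_ge_atTop N] with k hk
    have h := hq (k - N)
    rwa [Nat.add_sub_cancel' hk] at h
  calc τ.toFun (star (w N - Y) * (w N - Y))
      ≤ τ.toFun ((1 + (2 * C) ^ 2 : ℝ≥0) • q) :=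
        τ.mono (star_mul_mem (sub_mem (hw N) (hY.mem hw))) (smul_mem' q_mem _)
          (star_mul_self_nonneg _) limit_le
    _ = (1 + (2 * C) ^ 2 : ℝ≥0) * τ.toFun q := τ.toFun_smul _ q_mem q_nonneg
    _ ≤ _ := by gcongr; exact toFun_q_le

theorem exists_op_eq_and_tendsto_of_isWeakLim {U : Filter ℕ} [U.NeBot] (hU : U ≤ atTop)
    {x : ℕ → τ.PreL2} {Y : H →L[ℂ] H} {C : ℝ≥0} (hC : ∀ i, ‖(x i).op‖ ≤ C)
    (hx : ∀ i, ‖x i - x (i + 1)‖ₑ ≤ 2⁻¹ ^ i) (hY : IsWeakLim U (fun i => (x i).op) Y) :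
    ∃ W : τ.PreL2, W.op = Y ∧ Tendsto x atTop (𝓝 W) := by
  have x_mem (i : ℕ) : (x i).op ∈ M := (x i).2.1
  have toFun_le (N : ℕ) : τ.toFun (star ((x N).op - Y) * ((x N).op - Y)) ≤
      (2 * (1 + 2 * C) * 2⁻¹ ^ N) ^ 2 := by
    refine (toFun_star_sub_mul_sub_isWeakLim_le hU x_mem hC hY N).trans ?_
    have sq_le : 1 + (2 * C) ^ 2 ≤ (1 + 2 * C) ^ 2 := by
      rw [add_sq, one_pow]
      gcongr
      simp
    calc _ ≤ ((1 + 2 * C) ^ 2 : ℝ≥0) * (4 * (2⁻¹ ^ N) ^ 2 : ℝ≥0∞) := by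
          gcongr
          refine le_trans (ENNReal.tsum_le_tsum fun j => ?_) (tsum_two_pow_mul_sq_le hx N)
          rw [PreL2.enorm_sq]
          exact le_rfl
      _ = (2 * (1 + 2 * C) * 2⁻¹ ^ N) ^ 2 := by push_cast; ring
  have sub_mem_sub2 : (x 0).op - Y ∈ τ.sub2 :=
    ⟨sub_mem (x_mem 0) (hY.mem x_mem), (toFun_le 0).trans_lt (by finiteness)⟩
  let W : τ.PreL2 := ⟨Y, (sub_sub_cancel (x 0).op Y) ▸ τ.sub2.sub_mem (x 0).2 sub_mem_sub2⟩
  have enorm_le (N : ℕ) : ‖x N - W‖ₑ ≤ 2 * (1 + 2 * C) * 2⁻¹ ^ N :=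
    (ENNReal.pow_le_pow_left_iff two_ne_zero).1 ((x N - W).enorm_sq.trans_le (toFun_le N))
  have bound_tendsto : Tendsto (fun N => 2 * (1 + 2 * (C : ℝ≥0∞)) * 2⁻¹ ^ N) atTop (𝓝 0) := by
    simpa using ENNReal.Tendsto.const_mul (a := 2 * (1 + 2 * (C : ℝ≥0∞)))
      (ENNReal.tendsto_pow_atTop_nhds_zero_of_lt_one ENNReal.one_half_lt_one)
      (.inr (by finiteness))
  refine ⟨W, rfl, tendsto_iff_edist_tendsto_0.2 (tendsto_of_tendsto_of_tendsto_of_le_of_le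
    tendsto_const_nhds bound_tendsto (fun _ => zero_le) fun N => ?_)⟩
  exact (edist_eq_enorm_sub _ _).trans_le (enorm_le N)

end NSFTrace

theorem exists_seq_tendsto_enorm_sub_succ_le {E : Type*} [SeminormedAddCommGroup E]
    {S : Set E} {ζ : E} (hζ : ζ ∈ closure S) :
    ∃ x : ℕ → E, (∀ i, x i ∈ S) ∧ Tendsto x atTop (𝓝 ζ) ∧
      ∀ i, ‖x i - x (i + 1)‖ₑ ≤ 2⁻¹ ^ i := by
  have radius_pos (i : ℕ) : (0 : ℝ≥0∞) < 2⁻¹ * 2⁻¹ ^ i := by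
    rw [← pow_succ']
    exact ENNReal.pow_pos (ENNReal.inv_pos.2 ENNReal.ofNat_ne_top) _
  choose x x_mem hx using fun i => EMetric.mem_closure_iff.1 hζ _ (radius_pos i)
  have radius_tendsto : Tendsto (fun i : ℕ => (2⁻¹ : ℝ≥0∞) * 2⁻¹ ^ i) atTop (𝓝 0) := by
    simpa using ENNReal.Tendsto.const_mul (a := (2⁻¹ : ℝ≥0∞))
      (ENNReal.tendsto_pow_atTop_nhds_zero_of_lt_one ENNReal.one_half_lt_one)
      (.inr (by finiteness))
  refine ⟨x, x_mem, tendsto_iff_edist_tendsto_0.2 (tendsto_of_tendsto_of_tendsto_of_le_of_le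
    tendsto_const_nhds radius_tendsto (fun _ => zero_le) fun i => ?_), fun i => ?_⟩
  · exact (edist_comm _ _).trans_le (hx i).le
  calc ‖x i - x (i + 1)‖ₑ = edist (x i) (x (i + 1)) := (edist_eq_enorm_sub _ _).symm
    _ ≤ edist ζ (x i) + edist ζ (x (i + 1)) := by
      rw [edist_comm ζ]
      exact edist_triangle _ _ _
    _ ≤ 2⁻¹ * 2⁻¹ ^ i + 2⁻¹ * 2⁻¹ ^ i := by
      refine add_le_add (hx i).le ((hx (i + 1)).le.trans ?_)
      gcongr _ * ?_
      exact pow_le_pow_right_of_le_one' (by simp) i.le_succ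
    _ = 2⁻¹ ^ i := by rw [← add_mul, ENNReal.inv_two_add_inv_two, one_mul]

namespace NSFTrace

variable {H : Type*} [NormedAddCommGroup H] [InnerProductSpace ℂ H] [CompleteSpace H]
  {M : VonNeumannAlgebra H} {τ : NSFTrace M}

theorem PreL2.op_eq_of_coe_eq {x y : τ.PreL2} (h : (x : τ.L2) = y) : x.op = y.op := by
  have enorm_eq_zero : ‖x - y‖ₑ = 0 := by
    rw [← ofReal_norm, ← UniformSpace.Completion.norm_coe, UniformSpace.Completion.coe_sub, h,
      sub_self, norm_zero, ENNReal.ofReal_zero]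
  have toFun_eq_zero : τ.toFun (star (x - y).op * (x - y).op) = 0 := by
    rw [← PreL2.enorm_sq, enorm_eq_zero, zero_pow two_ne_zero]
  exact sub_eq_zero.1 <| CStarRing.star_mul_self_eq_zero_iff _ |>.1 <|
    τ.faithful _ (star_mul_mem (x - y).2.1) (star_mul_self_nonneg _) toFun_eq_zero

theorem PreL2.parallelogram (x y : τ.PreL2) :
    ‖x + y‖ ^ 2 + ‖x - y‖ ^ 2 = 2 * (‖x‖ ^ 2 + ‖y‖ ^ 2) := by
  have op_eq : star (x + y).op * (x + y).op + star (x - y).op * (x - y).op =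
      (((2 : ℝ≥0) : ℝ) : ℂ) • (star x.op * x.op) + (((2 : ℝ≥0) : ℝ) : ℂ) • (star y.op * y.op) := by
    change star (x.op + y.op) * (x.op + y.op) + star (x.op - y.op) * (x.op - y.op) = _
    simp only [NNReal.coe_ofNat, Complex.ofReal_ofNat, two_smul, star_add, star_sub]
    noncomm_ring
  have toFun_eq : τ.toFun (star (x + y).op * (x + y).op) + τ.toFun (star (x - y).op * (x - y).op) =
      2 * τ.toFun (star x.op * x.op) + 2 * τ.toFun (star y.op * y.op) := by
    refine (τ.map_add _ (star_mul_mem (x + y).2.1) _ (star_mul_mem (x - y).2.1)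
      (star_mul_self_nonneg _) (star_mul_self_nonneg _)).symm.trans ?_
    refine (congrArg τ.toFun op_eq).trans ?_
    exact τ.map_comb (star_mul_mem x.2.1) (star_mul_mem y.2.1) (star_mul_self_nonneg _)
      (star_mul_self_nonneg _) 2 2
  have enorm_eq : ‖x + y‖ₑ ^ 2 + ‖x - y‖ₑ ^ 2 = 2 * ‖x‖ₑ ^ 2 + 2 * ‖y‖ₑ ^ 2 := by
    simpa only [PreL2.enorm_sq] using toFun_eq
  have h := congrArg ENNReal.toReal enorm_eq
  rw [ENNReal.toReal_add (by finiteness) (by finiteness),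
    ENNReal.toReal_add (by finiteness) (by finiteness)] at h
  simpa [mul_add] using h

/-- `L_2(M)` is a Hilbert space. -/
@[reducible]
noncomputable def innerL2 (τ : NSFTrace M) : InnerProductSpace ℂ τ.L2 :=
  .ofNorm ℂ fun x y => by
    induction x, y using UniformSpace.Completion.induction_on₂ with
    | hp => exact isClosed_eq (by fun_prop) (by fun_prop)
    | ih x y =>
      simp only [← UniformSpace.Completion.coe_add, ← UniformSpace.Completion.coe_sub,
        UniformSpace.Completion.norm_coe, ← sq]
      exact x.parallelogram y

theorem PreL2.convex_setOf_norm_op_le (C : ℝ) : Convex ℝ {x : τ.PreL2 | ‖x.op‖ ≤ C} := by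
  let op : τ.PreL2 →ₗ[ℝ] H →L[ℂ] H :=
    { toFun := PreL2.op, map_add' := fun _ _ => rfl, map_smul' := fun _ _ => rfl }
  have preimage_eq : {x : τ.PreL2 | ‖x.op‖ ≤ C} = op ⁻¹' Metric.closedBall 0 C :=
    Set.ext fun x => mem_closedBall_zero_iff.symm
  exact preimage_eq ▸ (convex_closedBall 0 C).linear_preimage op

/-- The linear map `x ↦ (x, x ξ)`, which records a vector of `L_2(M)` together with the value of
the underlying operator at `ξ`. -/
noncomputable def PreL2.toL2Prod (τ : NSFTrace M) (ξ : H) : τ.PreL2 →ₗ[ℝ] τ.L2 × H where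
  toFun x := (x, x.op ξ)
  map_add' x y := Prod.ext (UniformSpace.Completion.coe_add x y) rfl
  map_smul' c x := Prod.ext (UniformSpace.Completion.coe_smul c x) rfl

theorem PreL2.exists_toL2Prod_eq_of_mem_closure {C : ℝ≥0} {ξ η : H} {ζ : τ.L2}
    (h : (ζ, η) ∈ closure (PreL2.toL2Prod τ ξ '' {x | ‖x.op‖ ≤ C})) :
    ∃ W : τ.PreL2, PreL2.toL2Prod τ ξ W = (ζ, η) := by
  obtain ⟨v, v_mem, v_tendsto, hv⟩ := exists_seq_tendsto_enorm_sub_succ_le h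
  choose x hx hxv using v_mem
  have coe_eq (i : ℕ) : (x i : τ.L2) = (v i).1 := congrArg Prod.fst (hxv i)
  have op_apply_eq (i : ℕ) : (x i).op ξ = (v i).2 := congrArg Prod.snd (hxv i)
  have enorm_le (i : ℕ) : ‖x i - x (i + 1)‖ₑ ≤ 2⁻¹ ^ i := by
    rw [← ofReal_norm, ← UniformSpace.Completion.norm_coe, UniformSpace.Completion.coe_sub,
      coe_eq, coe_eq]
    refine (ENNReal.ofReal_le_ofReal (norm_fst_le (v i - v (i + 1)))).trans ?_
    rw [ofReal_norm]
    exact hv i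
  obtain ⟨Y, -, hY⟩ := exists_isWeakLim_of_norm_le (hyperfilter ℕ) C.2 hx
  obtain ⟨W, rfl, x_tendsto⟩ :=
    exists_op_eq_and_tendsto_of_isWeakLim Nat.hyperfilter_le_atTop hx enorm_le hY
  refine ⟨W, Prod.ext ?_ (ext_inner_left ℂ fun θ => tendsto_nhds_unique (hY ξ θ) ?_)⟩
  · refine tendsto_nhds_unique ((UniformSpace.Completion.continuous_coe _).tendsto W |>.comp
      x_tendsto) ((continuous_fst.tendsto _).comp v_tendsto |>.congr fun i => ?_)
    exact (coe_eq i).symm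
  · simp only [op_apply_eq]
    exact tendsto_const_nhds.inner (((continuous_snd.tendsto _).comp v_tendsto).mono_left
      Nat.hyperfilter_le_atTop)

theorem PreL2.mem_closure_toL2Prod {ι : Type*} {U : Filter ι} [U.NeBot] {z : ι → τ.PreL2}
    {Z : H →L[ℂ] H} {C : ℝ} {ζ : τ.L2} (hC : ∀ k, ‖(z k).op‖ ≤ C)
    (hζ : ∀ f : StrongDual ℂ τ.L2, Tendsto (fun k => f (z k)) U (𝓝 (f ζ)))
    (hZ : IsWeakLim U (fun k => (z k).op) Z) (ξ : H) :
    (ζ, Z ξ) ∈ closure (PreL2.toL2Prod τ ξ '' {x | ‖x.op‖ ≤ C}) := by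
  refine mem_closure_of_tendsto_dual (U := U) ((PreL2.convex_setOf_norm_op_le C).linear_image _)
    (.of_forall fun k => ⟨z k, hC k, rfl⟩) fun f => ?_
  have apply_eq (a : τ.L2) (b : H) : f (a, b) = f.comp (.inl ℂ τ.L2 H) a +
      f.comp (.inr ℂ τ.L2 H) b := by
    rw [ContinuousLinearMap.comp_apply, ContinuousLinearMap.comp_apply, ← f.map_add]
    simp
  have inr_tendsto := hZ ξ ((InnerProductSpace.toDual ℂ H).symm (f.comp (.inr ℂ τ.L2 H)))
  simp only [InnerProductSpace.toDual_symm_apply] at inr_tendsto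
  rw [apply_eq]
  refine ((hζ (f.comp (.inl ℂ τ.L2 H))).add inr_tendsto).congr fun k => ?_
  exact (apply_eq _ _).symm

theorem PreL2.exists_op_eq_and_norm_le_of_isWeakLim {ι : Type*} {U : Ultrafilter ι}
    {z : ι → τ.PreL2} {Z : H →L[ℂ] H} {C : ℝ≥0} {ε : ℝ} (hC : ∀ k, ‖(z k).op‖ ≤ C)
    (hε : ∀ᶠ k in (U : Filter ι), ‖z k‖ ≤ ε) (hZ : IsWeakLim U (fun k => (z k).op) Z) :
    ∃ W : τ.PreL2, W.op = Z ∧ ‖W‖ ≤ ε := by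
  obtain ⟨ζ, norm_le, hζ⟩ : ∃ ζ : τ.L2, ‖ζ‖ ≤ ε ∧ ∀ f : StrongDual ℂ τ.L2,
      Tendsto (fun k => f (z k)) (U : Filter ι) (𝓝 (f ζ)) := by
    let _ := τ.innerL2
    obtain ⟨ζ, norm_le, hζ⟩ := exists_weakLimit_of_norm_le U
      (hε.mono fun k hk => (UniformSpace.Completion.norm_coe (z k)).trans_le hk)
    refine ⟨ζ, norm_le, fun f => ?_⟩
    simpa only [InnerProductSpace.toDual_symm_apply] using
      hζ ((InnerProductSpace.toDual ℂ τ.L2).symm f)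
  have exists_op_apply (ξ : H) : ∃ W : τ.PreL2, (W : τ.L2) = ζ ∧ W.op ξ = Z ξ := by
    obtain ⟨W, hW⟩ :=
      PreL2.exists_toL2Prod_eq_of_mem_closure (PreL2.mem_closure_toL2Prod hC hζ hZ ξ)
    exact ⟨W, congrArg Prod.fst hW, congrArg Prod.snd hW⟩
  obtain ⟨W, hW, -⟩ := exists_op_apply 0
  refine ⟨W, ContinuousLinearMap.ext fun ξ => ?_, ?_⟩
  · obtain ⟨W', hW', op_apply⟩ := exists_op_apply ξ
    rw [← op_apply, PreL2.op_eq_of_coe_eq (hW.trans hW'.symm)]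
  · rwa [← UniformSpace.Completion.norm_coe, hW]

end NSFTrace

/-! ### Common factorization in `L_2(M)` -/

theorem exists_tendsto_sum_of_denseRange {E F : Type*} [SeminormedAddCommGroup E]
    [SeminormedAddCommGroup F] {j : E →+ F} (hj : DenseRange j) {x : F} {c : ℝ} (hc : ‖x‖ < c) :
    ∃ g : ℕ → E, Tendsto (fun n => ∑ i ∈ Finset.range (n + 1), j (g i)) atTop (𝓝 x) ∧
      ∀ n, ∑ i ∈ Finset.range n, ‖j (g i)‖ ≤ c := by
  obtain ⟨b, b_pos, B, hB, B_le⟩ := posSumOfEncodable (sub_pos.2 hc) ℕ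
  obtain ⟨g, g_tendsto, g_zero, g_succ⟩ := controlled_sum_of_mem_closure_range (hj x) b_pos
  refine ⟨g, g_tendsto, fun n => ?_⟩
  have norm_le (i : ℕ) : ‖j (g i)‖ ≤ (if i = 0 then ‖x‖ else 0) + b i := by
    rcases i.eq_zero_or_pos with rfl | hi
    · rw [neg_add_eq_sub] at g_zero
      rw [if_pos rfl]
      exact (norm_le_norm_add_norm_sub _ _).trans (by gcongr)
    · rw [if_neg hi.ne', zero_add]
      exact (g_succ i hi).le
  calc ∑ i ∈ Finset.range n, ‖j (g i)‖
      ≤ (∑ i ∈ Finset.range n, if i = 0 then ‖x‖ else 0) + ∑ i ∈ Finset.range n, b i := by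
        rw [← Finset.sum_add_distrib]
        exact Finset.sum_le_sum fun i _ => norm_le i
    _ ≤ ‖x‖ + (c - ‖x‖) := by
        refine add_le_add ?_ ((sum_le_hasSum _ (fun i _ => (b_pos i).le) hB).trans B_le)
        rw [Finset.sum_ite_eq']
        split_ifs
        exacts [le_rfl, norm_nonneg x]
    _ = c := add_sub_cancel _ _

section Hilbert

variable {H : Type*} [NormedAddCommGroup H] [InnerProductSpace ℂ H] [CompleteSpace H]

theorem norm_inner_sum_le_norm_sqrt_mul_norm_sqrt {ι : Type*} {F : Finset ι}
    {a b x : ι → H →L[ℂ] H} (ha : ∀ j, 0 ≤ a j) (hb : ∀ j, 0 ≤ b j)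
    (h1 : ∀ j, x j * star (x j) ≤ a j * a j) (h2 : ∀ j, star (x j) * x j ≤ b j * b j) (ξ η : H) :
    ‖inner ℂ η ((∑ j ∈ F, x j) ξ)‖ ≤ ‖CFC.sqrt (∑ j ∈ F, a j) η‖ * ‖CFC.sqrt (∑ j ∈ F, b j) ξ‖ := by
  have norm_sqrt_sum {c : ι → H →L[ℂ] H} (hc : ∀ j, 0 ≤ c j) (ζ : H) :
      ‖CFC.sqrt (∑ j ∈ F, c j) ζ‖ = √(∑ j ∈ F, ‖CFC.sqrt (c j) ζ‖ ^ 2) := by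
    refine (Real.sqrt_eq_iff_mul_self_eq (by positivity) (norm_nonneg _) |>.2 ?_).symm
    rw [← sq, norm_sqrt_apply_sq (Finset.sum_nonneg fun j _ => hc j), sum_apply, inner_sum,
      Complex.re_sum]
    exact Finset.sum_congr rfl fun j _ => norm_sqrt_apply_sq (hc j) ζ
  calc ‖inner ℂ η ((∑ j ∈ F, x j) ξ)‖ ≤ ∑ j ∈ F, ‖inner ℂ η (x j ξ)‖ := by
        rw [sum_apply, inner_sum]
        exact norm_sum_le _ _
    _ ≤ ∑ j ∈ F, ‖CFC.sqrt (a j) η‖ * ‖CFC.sqrt (b j) ξ‖ := Finset.sum_le_sum fun j _ =>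
        norm_inner_le_norm_sqrt_mul_norm_sqrt (ha j) (hb j) (h1 j) (h2 j) ξ η
    _ ≤ ‖CFC.sqrt (∑ j ∈ F, a j) η‖ * ‖CFC.sqrt (∑ j ∈ F, b j) ξ‖ := by
        rw [norm_sqrt_sum ha, norm_sqrt_sum hb]
        exact Real.sum_mul_le_sqrt_mul_sqrt _ _ _

end Hilbert

namespace NSFTrace

variable {H : Type*} [NormedAddCommGroup H] [InnerProductSpace ℂ H] [CompleteSpace H]
  {M : VonNeumannAlgebra H} {τ : NSFTrace M}

theorem PreL2.op_sum {ι : Type*} (F : Finset ι) (g : ι → τ.PreL2) :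
    (∑ j ∈ F, g j).op = ∑ j ∈ F, (g j).op :=
  map_sum τ.sub2.subtype g F

theorem PreL2.exists_op_eq_star (x : τ.PreL2) : ∃ y : τ.PreL2, y.op = star x.op ∧ ‖y‖ = ‖x‖ := by
  have toFun_eq : τ.toFun (star (star x.op) * star x.op) = ‖x‖ₑ ^ 2 := by
    rw [star_star]
    exact (τ.tracial x.op x.2.1).symm.trans x.enorm_sq.symm
  let y : τ.PreL2 := ⟨star x.op, star_mem x.2.1, toFun_eq.trans_lt (by finiteness)⟩
  have enorm_eq : ‖y‖ₑ = ‖x‖ₑ :=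
    (ENNReal.pow_right_strictMono two_ne_zero).injective (y.enorm_sq.trans toFun_eq)
  exact ⟨y, rfl, by rw [← toReal_enorm, enorm_eq, toReal_enorm]⟩

theorem PreL2.exists_square_function {ι : Type*} [Fintype ι] (g : ι → τ.PreL2) :
    ∃ S : τ.PreL2, 0 ≤ S.op ∧ ‖S‖ = √(∑ i, ‖g i‖ ^ 2) ∧
      ∀ i, star (g i).op * (g i).op ≤ S.op * S.op := by
  let Q : H →L[ℂ] H := ∑ i, star (g i).op * (g i).op
  have Q_nonneg : 0 ≤ Q := Finset.sum_nonneg fun i _ => star_mul_self_nonneg _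
  have sqrt_mul_sqrt : CFC.sqrt Q * CFC.sqrt Q = Q := CFC.sqrt_mul_sqrt_self Q Q_nonneg
  have toFun_eq : τ.toFun (star (CFC.sqrt Q) * CFC.sqrt Q) = ∑ i, ‖g i‖ₑ ^ 2 := by
    rw [(CFC.sqrt_nonneg Q).isSelfAdjoint.star_eq, sqrt_mul_sqrt]
    refine (τ.toFun_sum Finset.univ (fun i => star_mul_mem (g i).2.1) fun i =>
      star_mul_self_nonneg (g i).op).trans ?_
    exact Finset.sum_congr rfl fun i _ => (g i).enorm_sq.symm
  have Q_mem : Q ∈ M := sum_mem fun i _ => star_mul_mem (g i).2.1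
  let S : τ.PreL2 := ⟨CFC.sqrt Q, sqrt_mem Q_mem,
    toFun_eq.trans_lt (ENNReal.sum_lt_top.2 fun i _ => by finiteness)⟩
  refine ⟨S, CFC.sqrt_nonneg Q, ?_, fun i => ?_⟩
  · refine (Real.sqrt_eq_iff_mul_self_eq (by positivity) (norm_nonneg _) |>.2 ?_).symm
    rw [← sq, ← toReal_enorm, ← ENNReal.toReal_pow, S.enorm_sq]
    refine Eq.symm ((congrArg _ toFun_eq).trans ?_)
    rw [ENNReal.toReal_sum fun i _ => by finiteness]
    simp only [ENNReal.toReal_pow, toReal_enorm]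
  · exact (Finset.single_le_sum (f := fun i => star (g i).op * (g i).op)
      (fun j _ => star_mul_self_nonneg _) (Finset.mem_univ i)).trans_eq sqrt_mul_sqrt.symm

namespace PreL4

theorem exists_op_eq_sqrt {A : τ.PreL2} (hA : 0 ≤ A.op) :
    ∃ u : τ.PreL4, u.op = CFC.sqrt A.op ∧ ‖u‖ ^ 2 = ‖A‖ := by
  have sqrt_mul_sqrt : CFC.sqrt A.op * CFC.sqrt A.op = A.op := CFC.sqrt_mul_sqrt_self _ hA
  have star_sqrt : star (CFC.sqrt A.op) = CFC.sqrt A.op :=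
    (CFC.sqrt_nonneg A.op).isSelfAdjoint.star_eq
  have toFun_eq : τ.toFun ((star (CFC.sqrt A.op) * CFC.sqrt A.op) ^ 2) = ‖A‖ₑ ^ 2 := by
    rw [star_sqrt, sqrt_mul_sqrt, PreL2.enorm_sq_of_nonneg hA, sq]
  let u : τ.PreL4 := ⟨CFC.sqrt A.op, sqrt_mem A.2.1, by rw [toFun_eq]; finiteness⟩
  have enorm_eq : (‖u‖ₑ ^ 2) ^ 2 = ‖A‖ₑ ^ 2 := by
    rw [← pow_mul, ← toFun_eq, sq]
    exact u.enorm_pow_four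
  refine ⟨u, rfl, ?_⟩
  rw [← toReal_enorm, ← toReal_enorm, ← ENNReal.toReal_pow,
    (ENNReal.pow_right_strictMono two_ne_zero).injective enorm_eq]

theorem cauchySeq_of_monotone_op {u : ℕ → τ.PreL4} {c : ℝ} (h0 : ∀ k, 0 ≤ (u k).op)
    (hu : Monotone fun k => (u k).op) (hc : ∀ k, ‖u k‖ ≤ c) : CauchySeq u := by
  have norm_sub_pow_four_le {k l : ℕ} (hkl : k ≤ l) :
      ‖u l - u k‖ ^ 4 ≤ ‖u l‖ ^ 4 - ‖u k‖ ^ 4 := norm_sub_pow_four_le (h0 k) (hu hkl)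
  have norm_monotone : Monotone fun k => ‖u k‖ ^ 4 := fun k l hkl =>
    sub_nonneg.1 ((by positivity : 0 ≤ ‖u l - u k‖ ^ 4).trans (norm_sub_pow_four_le hkl))
  have bddAbove : BddAbove (Set.range fun k => ‖u k‖ ^ 4) :=
    ⟨c ^ 4, Set.forall_mem_range.2 fun k => pow_le_pow_left₀ (norm_nonneg _) (hc k) 4⟩
  have cauchySeq_norm := (tendsto_atTop_ciSup norm_monotone bddAbove).cauchySeq
  refine Metric.cauchySeq_iff'.2 fun ε hε => ?_
  obtain ⟨N, hN⟩ := Metric.cauchySeq_iff'.1 cauchySeq_norm (ε ^ 4) (by positivity)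
  refine ⟨N, fun k hk => ?_⟩
  rw [dist_eq_norm]
  exact lt_of_pow_lt_pow_left₀ 4 hε.le <|
    (norm_sub_pow_four_le hk).trans_lt ((le_abs_self _).trans_lt (hN k hk))

theorem exists_tendsto_sqrt_sum {S : ℕ → τ.PreL2} {c : ℝ} (h0 : ∀ j, 0 ≤ (S j).op)
    (hc : ∀ n, ∑ j ∈ Finset.range n, ‖S j‖ ≤ c) :
    ∃ (u : ℕ → τ.PreL4) (a : τ.L4),
      (∀ k, (u k).op = CFC.sqrt (∑ j ∈ Finset.range (k + 1), (S j).op)) ∧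
      Tendsto (fun k => (u k : τ.L4)) atTop (𝓝 a) ∧ ‖a‖ ^ 2 ≤ c := by
  have sum_nonneg (k : ℕ) : 0 ≤ (∑ j ∈ Finset.range (k + 1), S j).op := by
    rw [PreL2.op_sum]
    exact Finset.sum_nonneg fun j _ => h0 j
  choose u op_u norm_u using fun k => exists_op_eq_sqrt (sum_nonneg k)
  have norm_u_sq_le (k : ℕ) : ‖u k‖ ^ 2 ≤ c := by
    rw [norm_u]
    exact (norm_sum_le _ _).trans (hc (k + 1))
  have u_cauchySeq : CauchySeq u := by
    refine cauchySeq_of_monotone_op (c := √c) (fun k => ?_) (fun k l hkl => ?_) fun k =>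
      Real.le_sqrt_of_sq_le (norm_u_sq_le k)
    · rw [op_u]
      exact CFC.sqrt_nonneg _
    · simp only [op_u, PreL2.op_sum]
      exact CFC.sqrt_le_sqrt _ _ (Finset.sum_le_sum_of_subset_of_nonneg
        (Finset.range_mono (by lia)) fun j _ _ => h0 j)
  have coe_cauchySeq : CauchySeq fun k => (u k : τ.L4) :=
    u_cauchySeq.map (UniformSpace.Completion.uniformContinuous_coe τ.PreL4)
  obtain ⟨a, ha⟩ := cauchySeq_tendsto_of_complete coe_cauchySeq
  refine ⟨u, a, fun k => by rw [op_u, PreL2.op_sum], ha,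
    le_of_tendsto (ha.norm.pow 2) (.of_forall fun k => ?_)⟩
  rw [UniformSpace.Completion.norm_coe]
  exact norm_u_sq_le k

end PreL4

theorem PreL2.exists_op_eq_mul_mul_sub {ι : Type*} {U : Ultrafilter ι} {u v : ι → τ.PreL4}
    {w : ι → τ.PreL2} {y : ι → H →L[ℂ] H} {Y : H →L[ℂ] H} {a b : τ.L4} {x : τ.L2}
    (hu : Tendsto (fun k => (u k : τ.L4)) U (𝓝 a)) (hv : Tendsto (fun k => (v k : τ.L4)) U (𝓝 b))
    (hw : Tendsto (fun k => (w k : τ.L2)) U (𝓝 x)) (hy : ∀ k, y k ∈ M) (hy1 : ∀ k, ‖y k‖ ≤ 1)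
    (hY : IsWeakLim (U : Filter ι) y Y) (hwy : ∀ k, (w k).op = (u k).op * y k * (v k).op)
    (p q : τ.PreL4) (e : τ.PreL2) :
    ∃ W : τ.PreL2, W.op = p.op * Y * q.op - e.op ∧
      ‖W‖ ≤ ‖(p : τ.L4) - a‖ * ‖q‖ + ‖a‖ * ‖(q : τ.L4) - b‖ + ‖x - (e : τ.L2)‖ := by
  choose f op_f norm_f using fun k => PreL4.exists_op_eq_mul_mul (p - u k) q (hy k) (hy1 k)
  choose g op_g norm_g using fun k => PreL4.exists_op_eq_mul_mul (u k) (q - v k) (hy k) (hy1 k)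
  let z (k : ι) : τ.PreL2 := f k + g k + (w k - e)
  have op_z (k : ι) : (z k).op = p.op * y k * q.op - e.op :=
    calc (z k).op = (f k).op + (g k).op + ((w k).op - e.op) := rfl
      _ = (p.op - (u k).op) * y k * q.op + (u k).op * y k * (q.op - (v k).op) +
          ((u k).op * y k * (v k).op - e.op) := by
        rw [op_f, op_g, hwy]
        rfl
      _ = p.op * y k * q.op - e.op := by noncomm_ring
  have norm_z_le (k : ι) : ‖z k‖ ≤
      ‖(p : τ.L4) - u k‖ * ‖q‖ + ‖(u k : τ.L4)‖ * ‖(q : τ.L4) - v k‖ + ‖(w k : τ.L2) - e‖ := by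
    simp only [← UniformSpace.Completion.coe_sub, UniformSpace.Completion.norm_coe]
    exact norm_add₃_le.trans (add_le_add_left (add_le_add (norm_f k) (norm_g k)) _)
  have bound_tendsto := (((hu.const_sub (p : τ.L4)).norm.mul_const ‖q‖).add
    (hu.norm.mul (hv.const_sub (q : τ.L4)).norm)).add (hw.sub_const (e : τ.L2)).norm
  have norm_op_z_le (k : ι) : ‖(z k).op‖ ≤ (‖p.op‖₊ * 1 * ‖q.op‖₊ + ‖e.op‖₊ : ℝ≥0) := by
    rw [op_z]
    push_cast
    refine (norm_sub_le _ _).trans (add_le_add_left (norm_mul₃_le.trans ?_) _)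
    gcongr
    exact hy1 k
  have op_z_isWeakLim : IsWeakLim (U : Filter ι) (fun k => (z k).op) (p.op * Y * q.op - e.op) := by
    simp only [op_z]
    exact (hY.mul_mul _ _).sub (isWeakLim_of_tendsto tendsto_const_nhds)
  have exists_le {c : ℝ}
      (hc : ‖(p : τ.L4) - a‖ * ‖q‖ + ‖a‖ * ‖(q : τ.L4) - b‖ + ‖x - (e : τ.L2)‖ < c) :
      ∃ W : τ.PreL2, W.op = p.op * Y * q.op - e.op ∧ ‖W‖ ≤ c :=
    PreL2.exists_op_eq_and_norm_le_of_isWeakLim norm_op_z_le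
      ((bound_tendsto.eventually_le_const hc).mono fun k hk => (norm_z_le k).trans hk)
      op_z_isWeakLim
  obtain ⟨W, op_W, -⟩ := exists_le (lt_add_one _)
  refine ⟨W, op_W, le_of_forall_gt_imp_ge_of_dense fun c hc => ?_⟩
  obtain ⟨W', op_W', norm_le⟩ := exists_le hc
  rwa [show W = W' from Subtype.ext (op_W.trans op_W'.symm)]

theorem isProd_of_isWeakLim {u v : ℕ → τ.PreL4} {w : ℕ → τ.PreL2} {y : ℕ → H →L[ℂ] H}
    {Y : H →L[ℂ] H} {a b : τ.L4} {x : τ.L2} {U : Ultrafilter ℕ} (hU : (U : Filter ℕ) ≤ atTop)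
    (hu : Tendsto (fun k => (u k : τ.L4)) atTop (𝓝 a))
    (hv : Tendsto (fun k => (v k : τ.L4)) atTop (𝓝 b))
    (hw : Tendsto (fun k => (w k : τ.L2)) atTop (𝓝 x)) (hy : ∀ k, y k ∈ M)
    (hy1 : ∀ k, ‖y k‖ ≤ 1) (hY : IsWeakLim (U : Filter ℕ) y Y)
    (hwy : ∀ k, (w k).op = (u k).op * y k * (v k).op) : τ.IsProd a Y b x := by
  choose W op_W norm_W using fun k => PreL2.exists_op_eq_mul_mul_sub (hu.mono_left hU)
    (hv.mono_left hU) (hw.mono_left hU) hy hy1 hY hwy (u k) (v k) (w k)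
  have bound_tendsto : Tendsto (fun k => ‖(u k : τ.L4) - a‖ * ‖v k‖ + ‖a‖ * ‖(v k : τ.L4) - b‖ +
      ‖x - (w k : τ.L2)‖) atTop (𝓝 0) := by
    simpa using ((tendsto_iff_norm_sub_tendsto_zero.1 hu |>.mul hv.norm).add
      ((tendsto_iff_norm_sub_tendsto_zero.1 hv).const_mul ‖a‖)).add
      (hw.const_sub x).norm
  have W_tendsto : Tendsto (fun k => (W k : τ.L2)) atTop (𝓝 0) :=
    squeeze_zero_norm (fun k => (UniformSpace.Completion.norm_coe _).trans_le (norm_W k))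
      bound_tendsto
  refine ⟨u, v, fun k => w k + W k, fun k => ?_, hu, hv, ?_⟩
  · calc (w k + W k).op = (w k).op + (W k).op := rfl
      _ = (u k).op * Y * (v k).op := by rw [op_W, add_sub_cancel]
  · simpa only [UniformSpace.Completion.coe_add, add_zero] using hw.add W_tendsto

theorem exists_series_of_sum_norm_sq_lt {ι : Type*} [Fintype ι] (x : ι → τ.L2) {c : ℝ}
    (hc : √(∑ i, ‖x i‖ ^ 2) < c) :
    ∃ g : ℕ → ι → τ.PreL2,
      (∀ i, Tendsto (fun k => ((∑ j ∈ Finset.range (k + 1), g j i : τ.PreL2) : τ.L2)) atTop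
        (𝓝 (x i))) ∧
      ∀ n, ∑ j ∈ Finset.range n, √(∑ i, ‖g j i‖ ^ 2) ≤ c := by
  let j : (ι → τ.PreL2) →+ PiLp 2 fun _ : ι => τ.L2 :=
    (WithLp.addEquiv 2 (ι → τ.L2)).symm.toAddMonoidHom.comp
      (AddMonoidHom.compLeft UniformSpace.Completion.toCompl ι)
  have j_denseRange : DenseRange j :=
    (WithLp.toLp_surjective 2).denseRange.comp
      (DenseRange.piMap fun _ : ι => UniformSpace.Completion.denseRange_coe)
      (PiLp.continuous_toLp 2 _)
  have norm_x : ‖WithLp.toLp 2 x‖ < c := by rwa [PiLp.norm_eq_of_L2]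
  obtain ⟨g, g_tendsto, sum_le⟩ := exists_tendsto_sum_of_denseRange j_denseRange norm_x
  refine ⟨g, fun i => ?_, fun n => ?_⟩
  · refine (((PiLp.continuous_apply 2 (fun _ : ι => τ.L2) i).tendsto _).comp g_tendsto).congr
      fun k => ?_
    rw [Function.comp_apply, ← map_sum, ← Finset.sum_apply]
    rfl
  · simpa [PiLp.norm_eq_of_L2, j] using sum_le n

theorem exists_common_factorization {ι : Type*} [Fintype ι] (x : ι → τ.L2) {c : ℝ}
    (hc : ∑ i, ‖x i‖ ^ 2 < c) :
    ∃ (a b : τ.L4) (y : ι → H →L[ℂ] H),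
      (∀ i, y i ∈ M ∧ ‖y i‖ ≤ 1 ∧ τ.IsProd a (y i) b (x i)) ∧ ‖a‖ ^ 4 ≤ c ∧ ‖b‖ ^ 4 ≤ c := by
  obtain ⟨g, g_tendsto, sum_le⟩ := exists_series_of_sum_norm_sq_lt x
    (Real.sqrt_lt_sqrt (by positivity) hc)
  choose g' op_g' norm_g' using fun j i => (g j i).exists_op_eq_star
  choose S S_nonneg norm_S le_S using fun j => PreL2.exists_square_function (g' j)
  choose T T_nonneg norm_T le_T using fun j => PreL2.exists_square_function (g j)
  obtain ⟨u, a, op_u, hu, norm_a⟩ := PreL4.exists_tendsto_sqrt_sum S_nonneg (c := √c) (by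
    simpa only [norm_S, norm_g'] using sum_le)
  obtain ⟨v, b, op_v, hv, norm_b⟩ := PreL4.exists_tendsto_sqrt_sum T_nonneg (c := √c) (by
    simpa only [norm_T] using sum_le)
  have exists_factor (i : ι) (k : ℕ) : ∃ y ∈ M, ‖y‖ ≤ 1 ∧
      (∑ j ∈ Finset.range (k + 1), g j i : τ.PreL2).op = (u k).op * y * (v k).op := by
    refine exists_eq_mul_mul_of_norm_inner_le (u k).2.1 (v k).2.1
      (∑ j ∈ Finset.range (k + 1), g j i : τ.PreL2).2.1 (op_u k ▸ CFC.sqrt_nonneg _)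
      (op_v k ▸ CFC.sqrt_nonneg _) fun ξ η => ?_
    rw [op_u, op_v, PreL2.op_sum]
    refine norm_inner_sum_le_norm_sqrt_mul_norm_sqrt S_nonneg T_nonneg (fun j => ?_)
      (fun j => le_T j i) ξ η
    simpa only [op_g', star_star] using le_S j i
  choose y y_mem norm_y_le op_eq using exists_factor
  choose Y norm_Y_le hY using fun i =>
    exists_isWeakLim_of_norm_le (hyperfilter ℕ) zero_le_one (norm_y_le i)
  have pow_four_le {t : ℝ} (ht : t ^ 2 ≤ √c) : t ^ 4 ≤ c := by
    rw [show t ^ 4 = (t ^ 2) ^ 2 by ring]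
    exact (Real.le_sqrt (sq_nonneg t) ((by positivity : 0 ≤ ∑ i, ‖x i‖ ^ 2).trans hc.le)).1 ht
  exact ⟨a, b, Y, fun i => ⟨(hY i).mem (y_mem i), norm_Y_le i, isProd_of_isWeakLim
    Nat.hyperfilter_le_atTop hu hv (g_tendsto i) (y_mem i) (norm_y_le i) (hY i) (op_eq i)⟩,
    pow_four_le norm_a, pow_four_le norm_b⟩

end NSFTrace

/-! ### The maximal norm of a finite-valued family -/

section FibreOperators

variable {H : Type*} [NormedAddCommGroup H] [InnerProductSpace ℂ H] [CompleteSpace H]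
  {Ω : Type*} [MeasurableSpace Ω] {μ : Measure Ω}

/-- The action of `L_∞(Ω; B(H))` on `L_2(Ω; H)` fibre by fibre. -/
noncomputable def fibreOp : Lp (H →L[ℂ] H) ∞ μ →L[ℂ] Lp H 2 μ →L[ℂ] Lp H 2 μ :=
  (ContinuousLinearMap.id ℂ (H →L[ℂ] H)).holderL μ ∞ 2 2

theorem coeFn_fibreOp (y : Lp (H →L[ℂ] H) ∞ μ) (ξ : Lp H 2 μ) :
    fibreOp y ξ =ᵐ[μ] fun t => y t (ξ t) :=
  (ContinuousLinearMap.id ℂ (H →L[ℂ] H)).coeFn_holder y ξ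

theorem coeFn_fibreOp_toLp {y : Ω → H →L[ℂ] H} (hy : MemLp y ∞ μ) (ξ : Lp H 2 μ) :
    fibreOp (hy.toLp y) ξ =ᵐ[μ] fun t => y t (ξ t) := by
  filter_upwards [coeFn_fibreOp (hy.toLp y) ξ, hy.coeFn_toLp] with t h1 h2
  rw [h1, h2]

theorem norm_fibreOp_le (y : Lp (H →L[ℂ] H) ∞ μ) : ‖fibreOp y‖ ≤ ‖y‖ := by
  refine ((fibreOp (μ := μ)).le_opNorm y).trans (mul_le_of_le_one_left (norm_nonneg y) ?_)
  exact (ContinuousLinearMap.norm_holderL_le _).trans ContinuousLinearMap.norm_id_le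

theorem tensorGenerators_subset_tensorVN (M : VonNeumannAlgebra H) (μ : Measure Ω) :
    tensorGenerators M μ ⊆ (tensorVN M μ : Set (Lp H 2 μ →L[ℂ] Lp H 2 μ)) :=
  (StarAlgebra.subset_adjoin ℂ _).trans (StarAlgebra.adjoin_le_centralizer_centralizer ℂ _)

theorem mem_tensorVN_of_finite [IsFiniteMeasure μ] {M : VonNeumannAlgebra H} {Q : Type*} [Finite Q]
    [MeasurableSpace Q] [MeasurableSingletonClass Q] {π : Ω → Q} (hπ : Measurable π)
    {y : Q → H →L[ℂ] H} (hy : ∀ q, y q ∈ M) {T : Lp H 2 μ →L[ℂ] Lp H 2 μ}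
    (hT : ∀ ξ, T ξ =ᵐ[μ] fun t => y (π t) (ξ t)) : T ∈ tensorVN M μ := by
  classical
  have := Fintype.ofFinite Q
  have memLp_indicator (q : Q) : MemLp ((π ⁻¹' {q}).indicator fun _ => (1 : ℂ)) ∞ μ :=
    (memLp_const 1).indicator (hπ (measurableSet_singleton q))
  let P (q : Q) : Lp H 2 μ →L[ℂ] Lp H 2 μ :=
    (ContinuousLinearMap.lsmul ℂ ℂ).holderL μ ∞ 2 2 ((memLp_indicator q).toLp _)
  let L (q : Q) : Lp H 2 μ →L[ℂ] Lp H 2 μ := (y q).compLpL 2 μ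
  have coeFn_P (q : Q) (ξ : Lp H 2 μ) :
      P q ξ =ᵐ[μ] fun t => (π ⁻¹' {q}).indicator (fun _ => (1 : ℂ)) t • ξ t := by
    filter_upwards [(ContinuousLinearMap.lsmul ℂ ℂ).coeFn_holder (r := 2)
      ((memLp_indicator q).toLp _) ξ, (memLp_indicator q).coeFn_toLp] with t h1 h2
    refine h1.trans ?_
    rw [h2]
    rfl
  have T_eq : T = ∑ q, P q * L q := by
    ext1 ξ
    refine Lp.ext ?_
    rw [sum_apply]
    filter_upwards [hT ξ, Lp.coeFn_fun_finsetSum Finset.univ fun q => (P q * L q) ξ,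
      ae_all_iff.2 fun q => coeFn_P q (L q ξ),
      ae_all_iff.2 fun q => (y q).coeFn_compLpL ξ] with t h1 h2 h3 h4
    rw [h1, h2, Finset.sum_eq_single (π t) (fun q _ hq => ?_) (by simp)]
    · refine Eq.symm ((h3 _).trans ?_)
      rw [Set.indicator_of_mem (s := π ⁻¹' {π t}) rfl, one_smul]
      exact h4 _
    · refine (h3 q).trans ?_
      rw [Set.indicator_of_notMem (s := π ⁻¹' {q}) (fun h => hq (Set.mem_singleton_iff.1 h).symm),
        zero_smul]
  rw [T_eq]
  exact sum_mem fun q _ => mul_mem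
    (tensorGenerators_subset_tensorVN M μ (.inl ⟨_, memLp_indicator q, coeFn_P q⟩))
    (tensorGenerators_subset_tensorVN M μ (.inr ⟨y q, hy q, (y q).coeFn_compLpL⟩))

end FibreOperators

section MaxNorm

theorem enorm_toLp_four_pow_four {Ω E : Type*} [MeasurableSpace Ω] {μ : Measure Ω}
    [NormedAddCommGroup E] {a : Ω → E} (ha : MemLp a 4 μ) :
    ‖ha.toLp a‖ₑ ^ 4 = ∫⁻ t, ‖a t‖ₑ ^ 4 ∂μ := by
  rw [Lp.enorm_toLp]
  have pow_eq := eLpNorm_nnreal_pow_eq_lintegral (f := a) (μ := μ) (p := 4) four_ne_zero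
  rw [NNReal.coe_ofNat, ENNReal.coe_ofNat] at pow_eq
  simpa only [ENNReal.rpow_ofNat] using pow_eq

variable {H : Type*} [NormedAddCommGroup H] [InnerProductSpace ℂ H] [CompleteSpace H]
  {M : VonNeumannAlgebra H} {τ : NSFTrace M} {Ω : Type*} [MeasurableSpace Ω] {μ : Measure Ω}
  {ι : Type*} {x : ι → L2N τ μ}

theorem maxNorm_le_enorm_mul_enorm {a b : L4N τ μ} {Y : ι → tensorVN M μ}
    (hY : ∀ i, ‖(Y i : Lp H 2 μ →L[ℂ] Lp H 2 μ)‖ ≤ 1) (h : ∀ i, IsProdN τ μ a (Y i) b (x i)) :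
    maxNorm τ μ x ≤ ‖a‖ₑ * ‖b‖ₑ := by
  have iSup_le_one : ⨆ i, ‖(Y i : Lp H 2 μ →L[ℂ] Lp H 2 μ)‖ₑ ≤ 1 := iSup_le fun i => by
    rw [← ofReal_norm]
    exact ENNReal.ofReal_le_one.2 (hY i)
  calc maxNorm τ μ x ≤ (⨆ i, ‖(Y i : Lp H 2 μ →L[ℂ] Lp H 2 μ)‖ₑ) * ‖a‖ₑ * ‖b‖ₑ :=
        iInf_le_of_le a <| iInf_le_of_le b <| iInf_le_of_le Y <| iInf_le_of_le ⟨1, hY⟩ <|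
          iInf_le _ h
    _ ≤ 1 * ‖a‖ₑ * ‖b‖ₑ := by gcongr
    _ = ‖a‖ₑ * ‖b‖ₑ := by rw [one_mul]

variable {Q : Type*} [Finite Q] [MeasurableSpace Q] [MeasurableSingletonClass Q] {π : Ω → Q}
  {D : Type*} [Fintype D] {δ : ι → Q → D} {X : D → Q → τ.L2}

theorem memLp_comp_of_finite [IsFiniteMeasure μ] {E : Type*} [NormedAddCommGroup E]
    (hπ : Measurable π) (c : Q → E) (p : ℝ≥0∞) : MemLp (fun t => c (π t)) p μ :=
  (MemLp.of_discrete (f := c)).comp_of_map hπ.aemeasurable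

theorem exists_isProdN_of_finite [IsFiniteMeasure μ] (hπ : Measurable π)
    (hx : ∀ i, x i =ᵐ[μ] fun t => X (δ i (π t)) (π t)) {c : Q → ℝ}
    (hc : ∀ q, ∑ d, ‖X d q‖ ^ 2 < c q) :
    ∃ (a b : L4N τ μ) (Y : ι → tensorVN M μ),
      (∀ i, ‖(Y i : Lp H 2 μ →L[ℂ] Lp H 2 μ)‖ ≤ 1) ∧ (∀ i, IsProdN τ μ a (Y i) b (x i)) ∧
      ‖a‖ₑ ^ 4 ≤ ∫⁻ t, ENNReal.ofReal (c (π t)) ∂μ ∧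
      ‖b‖ₑ ^ 4 ≤ ∫⁻ t, ENNReal.ofReal (c (π t)) ∂μ := by
  choose a b y hy ha hb using fun q => NSFTrace.exists_common_factorization (X · q) (hc q)
  have memLp_y (i : ι) : MemLp (fun t => y (π t) (δ i (π t))) ∞ μ :=
    memLp_comp_of_finite hπ (fun q => y q (δ i q)) ∞
  let Y (i : ι) : tensorVN M μ := ⟨fibreOp ((memLp_y i).toLp _),
    mem_tensorVN_of_finite hπ (fun q => (hy q (δ i q)).1) (coeFn_fibreOp_toLp (memLp_y i))⟩
  have enorm_pow_four_le {f : Q → τ.L4} (hf : ∀ q, ‖f q‖ ^ 4 ≤ c q) :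
      ‖(memLp_comp_of_finite (μ := μ) hπ f 4).toLp _‖ₑ ^ 4 ≤
        ∫⁻ t, ENNReal.ofReal (c (π t)) ∂μ := by
    rw [enorm_toLp_four_pow_four]
    refine lintegral_mono fun t => ?_
    rw [← ofReal_norm, ← ENNReal.ofReal_pow (norm_nonneg _)]
    exact ENNReal.ofReal_le_ofReal (hf _)
  refine ⟨_, _, Y, fun i => ?_, fun i => ?_, enorm_pow_four_le ha, enorm_pow_four_le hb⟩
  · refine (norm_fibreOp_le _).trans ?_
    rw [Lp.norm_toLp, eLpNorm_exponent_top]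
    refine ENNReal.toReal_le_of_le_ofReal zero_le_one
      (eLpNormEssSup_le_of_ae_bound (.of_forall fun t => (hy _ _).2.1))
  · refine ⟨_, ⟨fun t => (hy (π t) (δ i (π t))).1, coeFn_fibreOp_toLp (memLp_y i)⟩, ?_⟩
    filter_upwards [(memLp_comp_of_finite (μ := μ) hπ a 4).coeFn_toLp,
      (memLp_comp_of_finite (μ := μ) hπ b 4).coeFn_toLp, hx i] with t h1 h2 h3
    rw [h1, h2, h3]
    exact (hy _ _).2.2

theorem maxNorm_sq_le_lintegral_square_function [IsProbabilityMeasure μ] (hπ : Measurable π)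
    (hx : ∀ i, x i =ᵐ[μ] fun t => X (δ i (π t)) (π t)) :
    maxNorm τ μ x ^ 2 ≤ ∫⁻ t, ∑ d, ‖X d (π t)‖ₑ ^ 2 ∂μ := by
  refine ENNReal.le_of_forall_pos_le_add fun ε hε _ => ?_
  obtain ⟨a, b, Y, norm_Y, isProdN, norm_a, norm_b⟩ := exists_isProdN_of_finite hπ hx
    fun q => lt_add_of_pos_right (∑ d, ‖X d q‖ ^ 2) (NNReal.coe_pos.2 hε)
  have lintegral_eq : ∫⁻ t, ENNReal.ofReal (∑ d, ‖X d (π t)‖ ^ 2 + ε) ∂μ =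
      ∫⁻ t, ∑ d, ‖X d (π t)‖ₑ ^ 2 ∂μ + ε := by
    have ofReal_eq (t : Ω) : ENNReal.ofReal (∑ d, ‖X d (π t)‖ ^ 2 + ε) =
        ∑ d, ‖X d (π t)‖ₑ ^ 2 + ε := by
      rw [ENNReal.ofReal_add (by positivity) ε.coe_nonneg, ENNReal.ofReal_coe_nnreal,
        ENNReal.ofReal_sum_of_nonneg fun _ _ => by positivity]
      simp only [ENNReal.ofReal_pow (norm_nonneg _), ofReal_norm]
    simp only [ofReal_eq]
    rw [lintegral_add_right _ measurable_const, lintegral_const, measure_univ, mul_one]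
  rw [lintegral_eq] at norm_a norm_b
  refine (ENNReal.pow_le_pow_left_iff two_ne_zero).1 ?_
  calc (maxNorm τ μ x ^ 2) ^ 2 ≤ ((‖a‖ₑ * ‖b‖ₑ) ^ 2) ^ 2 := by
        gcongr
        exact maxNorm_le_enorm_mul_enorm norm_Y isProdN
    _ = ‖a‖ₑ ^ 4 * ‖b‖ₑ ^ 4 := by ring
    _ ≤ _ := by
        rw [sq]
        gcongr

end MaxNorm

/-! ### Orthogonality of characters and of class indicators -/

section Characters

theorem trace_rightInv_eq_star_trace {n R : Type*} [Fintype n] [DecidableEq n] [CommRing R]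
    [StarRing R] {P A B : Matrix n n R} (hP : IsUnit P.det) (hA : A.conjTranspose * P * A = P)
    (hAB : A * B = 1) : B.trace = star A.trace := by
  have conjTranspose_mul : A.conjTranspose * P = P * B := by
    calc A.conjTranspose * P = A.conjTranspose * P * (A * B) := by rw [hAB, Matrix.mul_one]
      _ = (A.conjTranspose * P * A) * B := by simp only [Matrix.mul_assoc]
      _ = P * B := by rw [hA]
  calc B.trace = (P * B * P⁻¹).trace := by
        rw [Matrix.trace_mul_comm, Matrix.nonsing_inv_mul_cancel_left P B hP]
    _ = A.conjTranspose.trace := by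
        rw [← conjTranspose_mul, Matrix.mul_nonsing_inv_cancel_right P _ hP]
    _ = star A.trace := A.trace_conjTranspose

-- Weyl's unitary trick.
open scoped ComplexOrder in
theorem exists_posDef_conjTranspose_mul_mul_eq {K n 𝕜 : Type*} [Group K] [Finite K] [Fintype n]
    [DecidableEq n] [RCLike 𝕜] (ρ : K →* Matrix n n 𝕜) :
    ∃ P : Matrix n n 𝕜, P.PosDef ∧ ∀ g, (ρ g).conjTranspose * P * ρ g = P := by
  have := Fintype.ofFinite K
  refine ⟨∑ k, (ρ k).conjTranspose * ρ k,
    Matrix.posDef_sum Finset.univ_nonempty fun k _ => ?_, fun g => ?_⟩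
  · exact Matrix.PosDef.conjTranspose_mul_self _
      (Matrix.mulVec_injective_of_isUnit ((Group.isUnit k).map ρ))
  · rw [Finset.mul_sum, Finset.sum_mul]
    refine Fintype.sum_equiv (Equiv.mulRight g) _ _ fun k => ?_
    rw [Equiv.coe_mulRight, map_mul, Matrix.conjTranspose_mul]
    simp only [Matrix.mul_assoc]

variable {K : Type*} [Group K]

open scoped ComplexOrder in
theorem character_inv_eq_conj [Finite K] {d : ℕ} (ρ : Representation ℂ K (Fin d → ℂ)) (g : K) :
    ρ.character g⁻¹ = conj (ρ.character g) := by
  let A : K →* Matrix (Fin d) (Fin d) ℂ :=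
    (LinearMap.toMatrixAlgEquiv' : _ ≃ₐ[ℂ] Matrix (Fin d) (Fin d) ℂ).toMonoidHom.comp ρ
  have character_eq (k : K) : ρ.character k = (A k).trace := by
    rw [Representation.character, LinearMap.trace_eq_matrix_trace ℂ (Pi.basisFun ℂ (Fin d))]
    rfl
  obtain ⟨P, hP, invariant⟩ := exists_posDef_conjTranspose_mul_mul_eq A
  rw [character_eq, character_eq]
  refine trace_rightInv_eq_star_trace ((Matrix.isUnit_iff_isUnit_det P).1 hP.isUnit)
    (invariant g) ?_
  rw [← map_mul, mul_inv_cancel, map_one]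

theorem inv_card_mul_sum_irrChars [Fintype K] {φ ψ : K → ℂ} [Decidable (φ = ψ)]
    (hφ : φ ∈ irrChars K) (hψ : ψ ∈ irrChars K) :
    (Nat.card K : ℂ)⁻¹ * ∑ g, φ g * conj (ψ g) = if φ = ψ then 1 else 0 := by
  obtain ⟨d, ρ, _, rfl⟩ := hφ
  obtain ⟨e, σ, _, rfl⟩ := hψ
  let _ : Invertible (Nat.card K : ℂ) :=
    invertibleOfNonzero (Nat.cast_ne_zero.2 Nat.card_pos.ne')
  simp only [← character_inv_eq_conj]
  split_ifs with h
  · rw [← h, Representation.char_orthonormal, if_pos ⟨Representation.Equiv.refl ρ⟩]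
  · rw [Representation.char_orthonormal, if_neg]
    rintro ⟨equiv⟩
    exact h (Representation.char_iso equiv).symm

end Characters

section ClassIndex

variable {K : Type*} [Group K] [Finite K]

/-- The number of the conjugacy class of `x`, in an arbitrary enumeration of the classes. -/
noncomputable def classIdx (x : K) : Fin (Nat.card (ConjClasses K)) :=
  Finite.equivFin _ (ConjClasses.mk x)

theorem classIdx_eq_iff {x y : K} : classIdx x = classIdx y ↔ IsConj x y := by
  rw [classIdx, classIdx, EmbeddingLike.apply_eq_iff_eq, ConjClasses.mk_eq_mk_iff_isConj]

theorem classIdx_surjective : Function.Surjective (classIdx : K → _) :=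
  (Finite.equivFin (ConjClasses K)).surjective.comp ConjClasses.mk_surjective

end ClassIndex

section Uniform

open ProbabilityTheory

variable {K : Type*} [MeasurableSpace K]

/-- The probability of the conjugacy class of `x` under the uniform distribution. -/
noncomputable def classMass [Group K] (x : K) : ℝ :=
  (uniformOn (Set.univ : Set K)).real {z | IsConj x z}

theorem classMass_congr [Group K] {x y : K} (h : IsConj x y) : classMass x = classMass y :=
  congrArg (uniformOn (Set.univ : Set K)).real (Set.ext fun _ => ⟨h.symm.trans, h.trans⟩)

variable [MeasurableSingletonClass K]

theorem uniformOn_univ_real_pos [Finite K] {S : Set K} (hS : S.Nonempty) :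
    0 < (uniformOn (Set.univ : Set K)).real S := by
  refine ENNReal.toReal_pos (fun h => ?_) (measure_ne_top _ _)
  rw [uniformOn_eq_zero_iff Set.finite_univ, Set.univ_inter] at h
  exact hS.ne_empty h

theorem integral_uniformOn_univ [Fintype K] (h : K → ℂ) :
    ∫ z, h z ∂(uniformOn (Set.univ : Set K)) = (Nat.card K : ℂ)⁻¹ * ∑ z, h z := by
  have real_singleton (z : K) :
      (uniformOn (Set.univ : Set K)).real {z} = (Nat.card K : ℝ)⁻¹ := by
    simp [measureReal_def, uniformOn_univ]
  rw [integral_fintype .of_finite, Finset.mul_sum]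
  simp only [real_singleton, Complex.real_smul, Complex.ofReal_inv, Complex.ofReal_natCast]

variable [Group K] [Finite K]

theorem integral_irrChars_mul_conj {φ ψ : K → ℂ} [Decidable (φ = ψ)] (hφ : φ ∈ irrChars K)
    (hψ : ψ ∈ irrChars K) :
    ∫ z, φ z * conj (ψ z) ∂(uniformOn (Set.univ : Set K)) = if φ = ψ then 1 else 0 := by
  have := Fintype.ofFinite K
  rw [integral_uniformOn_univ, inv_card_mul_sum_irrChars hφ hψ]

theorem classMass_pos (x : K) : 0 < classMass x := uniformOn_univ_real_pos ⟨x, IsConj.refl x⟩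

/-- The indicator function of the `j`-th conjugacy class, normalized in `L_2`. -/
noncomputable def classFn (j : Fin (Nat.card (ConjClasses K))) (x : K) : ℂ :=
  if classIdx x = j then ((√(classMass x) : ℝ) : ℂ)⁻¹ else 0

open scoped Classical in
theorem classFn_classIdx_mul_conj (x y : K) :
    classFn (classIdx y) y * conj (classFn (classIdx y) x) =
      if IsConj y x then ((classMass y : ℝ) : ℂ)⁻¹ else 0 := by
  rw [classFn, classFn, if_pos rfl]
  split_ifs with h_idx h_conj h_conj
  · rw [classMass_congr h_conj, map_inv₀, Complex.conj_ofReal, ← mul_inv, ← Complex.ofReal_mul,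
      Real.mul_self_sqrt (classMass_pos x).le]
  · exact absurd (classIdx_eq_iff.1 h_idx.symm) h_conj
  · exact absurd (classIdx_eq_iff.2 h_conj).symm h_idx
  · rw [map_zero, mul_zero]

theorem integral_classFn_mul_conj (i j : Fin (Nat.card (ConjClasses K))) :
    ∫ x, classFn i x * conj (classFn j x) ∂(uniformOn (Set.univ : Set K)) =
      if i = j then 1 else 0 := by
  split_ifs with h
  · subst h
    obtain ⟨y, rfl⟩ := classIdx_surjective i
    have eq_indicator (x : K) : classFn (classIdx y) x * conj (classFn (classIdx y) x) =
        {z | IsConj y z}.indicator (fun _ => ((classMass y : ℝ) : ℂ)⁻¹) x := by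
      by_cases hx : IsConj y x
      · rw [Set.indicator_of_mem (s := {z | IsConj y z}) hx, classIdx_eq_iff.2 hx,
          classFn_classIdx_mul_conj, if_pos (IsConj.refl x), classMass_congr hx]
      · rw [Set.indicator_of_notMem (s := {z | IsConj y z}) hx, classFn,
          if_neg fun h => hx (classIdx_eq_iff.1 h).symm, zero_mul]
    simp only [eq_indicator]
    rw [integral_indicator_const _ (Set.toFinite _).measurableSet, Complex.real_smul]
    exact mul_inv_cancel₀ (Complex.ofReal_ne_zero.2 (classMass_pos y).ne')
  · refine integral_eq_zero_of_ae (.of_forall fun x => ?_)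
    simp only [classFn, Pi.zero_apply]
    split_ifs with hi hj
    · exact absurd (hi.symm.trans hj) h
    · rw [map_zero, mul_zero]
    all_goals exact zero_mul _

end Uniform

/-! ### Bessel's inequality for vector-valued functions -/

theorem sum_norm_sq_le_of_pairwise_inner_eq_zero {𝕜 E ι : Type*} [RCLike 𝕜] [NormedAddCommGroup E]
    [InnerProductSpace 𝕜 E] [Fintype ι] {u : ι → E} {x : E}
    (orthogonal : Pairwise fun i j => inner 𝕜 (u i) (u j) = 0)
    (inner_right : ∀ i, inner 𝕜 (u i) x = (‖u i‖ : 𝕜) ^ 2) : ∑ i, ‖u i‖ ^ 2 ≤ ‖x‖ ^ 2 := by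
  have inner_sum_eq : inner 𝕜 (∑ i, u i) x = inner 𝕜 (∑ i, u i) (∑ i, u i) := by
    rw [sum_inner, sum_inner]
    refine Finset.sum_congr rfl fun i _ => ?_
    rw [inner_sum, Finset.sum_eq_single i (fun j _ hj => orthogonal hj.symm) (by simp),
      inner_right, inner_self_eq_norm_sq_to_K]
  have norm_sum_sq : ‖∑ i, u i‖ ^ 2 = ∑ i, ‖u i‖ ^ 2 := by
    have cast_eq : ((‖∑ i, u i‖ ^ 2 : ℝ) : 𝕜) = ((∑ i, ‖u i‖ ^ 2 : ℝ) : 𝕜) := by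
      rw [RCLike.ofReal_pow, ← inner_self_eq_norm_sq_to_K, ← inner_sum_eq, sum_inner]
      simp only [inner_right, RCLike.ofReal_sum, RCLike.ofReal_pow]
    exact RCLike.ofReal_injective cast_eq
  have norm_sum_sq_le : ‖∑ i, u i‖ ^ 2 ≤ ‖∑ i, u i‖ * ‖x‖ := by
    calc ‖∑ i, u i‖ ^ 2 = ‖inner 𝕜 (∑ i, u i) x‖ := by
          rw [inner_sum_eq, inner_self_eq_norm_sq_to_K]; simp
      _ ≤ ‖∑ i, u i‖ * ‖x‖ := norm_inner_le_norm _ _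
  rw [← norm_sum_sq]
  nlinarith [sq_nonneg (‖x‖ - ‖∑ i, u i‖)]

section Bessel

variable {Ω : Type*} [MeasurableSpace Ω] {μ : Measure Ω}

theorem lintegral_enorm_sq_eq_one {φ : Ω → ℂ} (hφ : MemLp φ 2 μ)
    (normalized : ∫ x, φ x * conj (φ x) ∂μ = 1) : ∫⁻ x, ‖φ x‖ₑ ^ 2 ∂μ = 1 := by
  have integral_norm_sq : ∫ x, ‖φ x‖ ^ 2 ∂μ = 1 := by
    simp_rw [Complex.mul_conj, Complex.normSq_eq_norm_sq] at normalized
    rw [integral_complex_ofReal] at normalized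
    exact_mod_cast normalized
  calc ∫⁻ x, ‖φ x‖ₑ ^ 2 ∂μ = ∫⁻ x, ENNReal.ofReal (‖φ x‖ ^ 2) ∂μ := by
        simp only [ENNReal.ofReal_pow (norm_nonneg _), ofReal_norm]
    _ = ENNReal.ofReal (∫ x, ‖φ x‖ ^ 2 ∂μ) :=
        (ofReal_integral_eq_lintegral_ofReal hφ.norm.integrable_sq
          (.of_forall fun x => by positivity)).symm
    _ = 1 := by rw [integral_norm_sq, ENNReal.ofReal_one]

variable {E : Type*} [NormedAddCommGroup E]

theorem memLp_smul_const [NormedSpace ℂ E] {φ : Ω → ℂ} {p : ℝ≥0∞} (hφ : MemLp φ p μ) (v : E) :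
    MemLp (fun x => φ x • v) p μ :=
  (memLp_top_const v).smul hφ

variable [InnerProductSpace ℂ E] [CompleteSpace E]

theorem inner_toLp_smul_const {φ : Ω → ℂ} (hφ : MemLp φ 2 μ) (v : E) (f : Lp E 2 μ) :
    inner ℂ ((memLp_smul_const hφ v).toLp _) f = inner ℂ v (∫ x, conj (φ x) • f x ∂μ) := by
  have integrable : Integrable (fun x => conj (φ x) • f x) μ :=
    memLp_one_iff_integrable.1 ((Lp.memLp f).smul hφ.star)
  rw [L2.inner_def, ← integral_inner integrable]
  refine integral_congr_ae ?_
  filter_upwards [(memLp_smul_const hφ v).coeFn_toLp] with x hx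
  rw [hx, inner_smul_left, inner_smul_right]

variable {ι : Type*} [Fintype ι] [DecidableEq ι] {φ : ι → Ω → ℂ}

theorem sum_norm_integral_sq_le (hφ : ∀ i, MemLp (φ i) 2 μ)
    (orthonormal : ∀ i j, ∫ x, φ i x * conj (φ j x) ∂μ = if i = j then 1 else 0) (f : Lp E 2 μ) :
    ∑ i, ‖∫ x, conj (φ i x) • f x ∂μ‖ ^ 2 ≤ ‖f‖ ^ 2 := by
  let v (i : ι) : E := ∫ x, conj (φ i x) • f x ∂μ
  let u (i : ι) : Lp E 2 μ := (memLp_smul_const (hφ i) (v i)).toLp _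
  have inner_u (i j : ι) : inner ℂ (u i) (u j) = if i = j then (‖v i‖ : ℂ) ^ 2 else 0 := by
    have integral_eq : ∫ x, conj (φ i x) • u j x ∂μ = (if j = i then (1 : ℂ) else 0) • v j := by
      rw [← orthonormal, ← integral_smul_const]
      refine integral_congr_ae ?_
      filter_upwards [(memLp_smul_const (hφ j) (v j)).coeFn_toLp] with x hx
      rw [hx, smul_smul, mul_comm]
    rw [inner_toLp_smul_const (hφ i), integral_eq]
    split_ifs with h_symm h h
    · rw [one_smul, h_symm]
      exact inner_self_eq_norm_sq_to_K _
    · exact absurd h_symm.symm h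
    · exact absurd h.symm h_symm
    · rw [zero_smul, inner_zero_right]
  have norm_u (i : ι) : ‖u i‖ ^ 2 = ‖v i‖ ^ 2 := by
    rw [← inner_self_eq_norm_sq (𝕜 := ℂ), inner_u, if_pos rfl, ← Complex.ofReal_pow]
    rfl
  calc ∑ i, ‖v i‖ ^ 2 = ∑ i, ‖u i‖ ^ 2 := by simp only [norm_u]
    _ ≤ ‖f‖ ^ 2 := by
      refine sum_norm_sq_le_of_pairwise_inner_eq_zero (𝕜 := ℂ)
        (fun i j hij => (inner_u i j).trans (if_neg hij)) fun i => ?_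
      rw [inner_toLp_smul_const (hφ i), inner_self_eq_norm_sq_to_K]
      exact_mod_cast (norm_u i).symm

theorem lintegral_sum_enorm_smul_integral_sq_le (hφ : ∀ i, MemLp (φ i) 2 μ)
    (orthonormal : ∀ i j, ∫ x, φ i x * conj (φ j x) ∂μ = if i = j then 1 else 0) (f : Lp E 2 μ) :
    ∫⁻ x, ∑ i, ‖φ i x • ∫ z, conj (φ i z) • f z ∂μ‖ₑ ^ 2 ∂μ ≤ ‖f‖ₑ ^ 2 := by
  have lintegral_eq (i : ι) (v : E) : ∫⁻ x, ‖φ i x • v‖ₑ ^ 2 ∂μ = ‖v‖ₑ ^ 2 := by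
    simp only [enorm_smul, mul_pow]
    rw [lintegral_mul_const'' _ ((hφ i).1.enorm.pow_const 2),
      lintegral_enorm_sq_eq_one (hφ i) ((orthonormal i i).trans (if_pos rfl)), one_mul]
  rw [lintegral_finsetSum' _ fun i _ =>
    (memLp_smul_const (hφ i) _).1.enorm.pow_const 2]
  simp only [lintegral_eq]
  simp only [← ofReal_norm, ← ENNReal.ofReal_pow (norm_nonneg _)]
  rw [← ENNReal.ofReal_sum_of_nonneg fun i _ => by positivity]
  exact ENNReal.ofReal_le_ofReal (sum_norm_integral_sq_le hφ orthonormal f)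

end Bessel

/-! ### Expansions in the mixed radix `(P_k)` -/

section Digits

variable (Γ : ℕ → Type*) [∀ k, Group (Γ k)]

theorem bigP_succ (k : ℕ) : bigP Γ (k + 1) = bigP Γ k * numClasses Γ k :=
  Finset.prod_range_succ _ _

theorem bigP_dvd_bigP {k l : ℕ} (h : k ≤ l) : bigP Γ k ∣ bigP Γ l :=
  Finset.prod_dvd_prod_of_subset _ _ _ (Finset.range_mono h)

theorem sum_dig_mul_bigP (n N : ℕ) :
    ∑ k ∈ Finset.range N, dig Γ n k * bigP Γ k = n % bigP Γ N := by
  induction N with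
  | zero => simp [bigP, Nat.mod_one]
  | succ N ih => rw [Finset.sum_range_succ, ih, bigP_succ, Nat.mod_mul, dig, mul_comm (bigP Γ N)]

variable [∀ k, Finite (Γ k)]

theorem numClasses_pos (k : ℕ) : 0 < numClasses Γ k := Nat.card_pos

theorem one_lt_numClasses (k : ℕ) [Nontrivial (Γ k)] : 1 < numClasses Γ k := by
  obtain ⟨g, hg⟩ := exists_ne (1 : Γ k)
  have : Nontrivial (ConjClasses (Γ k)) := ⟨ConjClasses.mk g, ConjClasses.mk 1, fun h =>
    hg (isConj_one_left.1 (ConjClasses.mk_eq_mk_iff_isConj.1 h))⟩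
  exact Finite.one_lt_card

theorem bigP_pos (k : ℕ) : 0 < bigP Γ k := Finset.prod_pos fun i _ => numClasses_pos Γ i

theorem bigP_mono : Monotone (bigP Γ) := fun _ l h =>
  Nat.le_of_dvd (bigP_pos Γ l) (bigP_dvd_bigP Γ h)

theorem lt_bigP [∀ k, Nontrivial (Γ k)] (n : ℕ) : n < bigP Γ n :=
  calc n < 2 ^ n := Nat.lt_two_pow_self
    _ = ∏ _i ∈ Finset.range n, 2 := by rw [Finset.prod_const, Finset.card_range]
    _ ≤ bigP Γ n := Finset.prod_le_prod' fun i _ => one_lt_numClasses Γ i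

theorem lt_bigP_of_mem_block [∀ k, Nontrivial (Γ k)] {A n : ℕ} (hn : n ∈ block Γ A) :
    n < bigP Γ (A + 1) := by
  have dig_eq_zero {k : ℕ} (hk : A < k) : dig Γ n k = 0 :=
    of_not_not fun h => hk.not_ge (hn.2 h)
  have n_lt : n < bigP Γ (A + 1 + n) := (lt_bigP Γ n).trans_le (bigP_mono Γ (by lia))
  calc n = ∑ k ∈ Finset.range (A + 1 + n), dig Γ n k * bigP Γ k := by
        rw [sum_dig_mul_bigP, Nat.mod_eq_of_lt n_lt]
    _ = ∑ k ∈ Finset.range (A + 1), dig Γ n k * bigP Γ k := by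
        refine (Finset.sum_subset (Finset.range_mono (by lia)) fun k _ hk => ?_).symm
        rw [dig_eq_zero (by simpa using hk), zero_mul]
    _ = n % bigP Γ (A + 1) := sum_dig_mul_bigP Γ n (A + 1)
    _ < bigP Γ (A + 1) := Nat.mod_lt _ (bigP_pos Γ _)

variable {Γ} {n N : ℕ}

theorem dig_eq_zero_of_lt_bigP {k : ℕ} (hk : N ≤ k) (hn : n < bigP Γ N) : dig Γ n k = 0 := by
  rw [dig, Nat.div_eq_of_lt (hn.trans_le (bigP_mono Γ hk)), Nat.zero_mod]

theorem tail_eq (s : ℕ) (hn : n < bigP Γ N) : tail Γ s n = bigP Γ s * (n / bigP Γ s) := by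
  have tail_eq_sum : tail Γ s n = ∑ k ∈ Finset.Ico s (s + N), dig Γ n k * bigP Γ k := by
    rw [tail, ← finsum_mem_finset_eq_sum]
    refine finsum_congr fun k => ?_
    by_cases hk : s ≤ k
    · by_cases hk' : k < s + N
      · simp [hk, hk']
      · simp [dig_eq_zero_of_lt_bigP (show N ≤ k by lia) hn]
    · simp [hk]
  have split := Finset.sum_range_add_sum_Ico (fun k => dig Γ n k * bigP Γ k)
    (Nat.le_add_right s N)
  rw [← tail_eq_sum, sum_dig_mul_bigP, sum_dig_mul_bigP,
    Nat.mod_eq_of_lt (hn.trans_le (bigP_mono Γ (Nat.le_add_left N s)))] at split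
  exact Nat.add_left_cancel (split.trans (Nat.mod_add_div n (bigP Γ s)).symm)

theorem dig_tail (s k : ℕ) (hn : n < bigP Γ N) :
    dig Γ (tail Γ s n) k = if s ≤ k then dig Γ n k else 0 := by
  rw [tail_eq s hn, dig]
  split_ifs with h
  · obtain ⟨R, hR⟩ := bigP_dvd_bigP Γ h
    rw [dig, hR, Nat.mul_div_mul_left _ _ (bigP_pos Γ s), Nat.div_div_eq_div_mul]
  · obtain ⟨R, hR⟩ := bigP_dvd_bigP Γ (show k + 1 ≤ s by lia)
    rw [hR, bigP_succ, mul_assoc, mul_assoc, Nat.mul_div_cancel_left _ (bigP_pos Γ k),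
      Nat.mul_mod_right]

theorem chi_tail {r : ∀ k, ℕ → Γ k → ℂ} (hr : ∀ k, r k 0 = fun _ => 1) (s : ℕ)
    (hn : n < bigP Γ N) (x : ∀ k, Γ k) :
    chi r (tail Γ s n) x = ∏ k ∈ Finset.range N, if k < s then 1 else r k (dig Γ n k) (x k) := by
  rw [chi, finprod_eq_prod_of_mulSupport_subset (s := Finset.range N)]
  · refine Finset.prod_congr rfl fun k _ => ?_
    rw [dig_tail s k hn]
    by_cases h : k < s
    · rw [if_pos h, if_neg (not_le.2 h), hr]
    · rw [if_neg h, if_pos (not_lt.1 h)]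
  · refine Function.mulSupport_subset_iff'.2 fun k hk => ?_
    rw [dig_tail s k hn, dig_eq_zero_of_lt_bigP (by simpa using hk) hn, ite_self, hr]

end Digits

/-! ### The averages as Fourier multiples -/

section Averages

variable {Γ : ℕ → Type*} [∀ k, Group (Γ k)] [∀ k, Finite (Γ k)] [∀ k, MeasurableSpace (Γ k)]

/-- Orthonormal functions on `Γ k`: normalized indicators of conjugacy classes for `k < s`,
irreducible characters for `k ≥ s`. -/
noncomputable def mixedFn (r : ∀ k, ℕ → Γ k → ℂ) (s k : ℕ) (j : Fin (numClasses Γ k)) : Γ k → ℂ :=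
  if k < s then classFn j else r k j

/-- The product of the functions `mixedFn` with indices `m` over the coordinates in `I`. -/
noncomputable def mixedProd (r : ∀ k, ℕ → Γ k → ℂ) (s : ℕ) {I : Finset ℕ}
    (m : ∀ k : I, Fin (numClasses Γ k)) (q : ∀ k : I, Γ k) : ℂ :=
  ∏ k : I, mixedFn r s k (m k) (q k)

/-- The indices of the factors of `mixedProd` that make up the integral kernel of `avg r s n` near
`q`: the conjugacy class of `q k` for `k < s`, and the `k`-th digit of `n` for `k ≥ s`. -/
noncomputable def mixedIdx (s n : ℕ) {I : Finset ℕ} (q : ∀ k : I, Γ k) (k : I) :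
    Fin (numClasses Γ k) :=
  if (k : ℕ) < s then classIdx (q k) else ⟨dig Γ n k, Nat.mod_lt _ (numClasses_pos Γ k)⟩

variable [∀ k, MeasurableSingletonClass (Γ k)]

instance : IsProbabilityMeasure (haarG Γ) := by
  unfold haarG
  infer_instance

theorem integral_mixedFn_mul_conj {r : ∀ k, ℕ → Γ k → ℂ} (hr : IsCharacterSystem Γ r) (s k : ℕ)
    (i j : Fin (numClasses Γ k)) :
    ∫ x, mixedFn r s k i x * conj (mixedFn r s k j x)
      ∂(ProbabilityTheory.uniformOn (Set.univ : Set (Γ k))) = if i = j then 1 else 0 := by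
  classical
  by_cases h : k < s
  · simp only [mixedFn, if_pos h]
    exact integral_classFn_mul_conj i j
  · have r_eq_iff : r k i = r k j ↔ i = j := ((hr k).1.injOn.eq_iff i.2 j.2).trans Fin.ext_iff.symm
    simp only [mixedFn, if_neg h]
    rw [integral_irrChars_mul_conj ((hr k).1.mapsTo i.2) ((hr k).1.mapsTo j.2)]
    simp only [r_eq_iff]

theorem integral_mixedProd_mul_conj {r : ∀ k, ℕ → Γ k → ℂ} (hr : IsCharacterSystem Γ r) (s : ℕ)
    {I : Finset ℕ} (m l : ∀ k : I, Fin (numClasses Γ k)) :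
    ∫ x, mixedProd r s m (I.restrict x) * conj (mixedProd r s l (I.restrict x)) ∂(haarG Γ) =
      if m = l then 1 else 0 := by
  rw [haarG, integral_restrict_infinitePi (s := I)
    (μ := fun k => ProbabilityTheory.uniformOn (Set.univ : Set (Γ k)))
    (f := fun q => mixedProd r s m q * conj (mixedProd r s l q))
    StronglyMeasurable.of_discrete.aestronglyMeasurable]
  simp only [mixedProd, map_prod, ← Finset.prod_mul_distrib]
  rw [integral_fintype_prod_eq_prod
    (f := fun k : I => fun z => mixedFn r s k (m k) z * conj (mixedFn r s k (l k) z))]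
  simp only [integral_mixedFn_mul_conj hr]
  split_ifs with h
  · simp [h]
  · obtain ⟨k, hk⟩ := Function.ne_iff.1 h
    exact Finset.prod_eq_zero (Finset.mem_univ k) (if_neg hk)

theorem measurableSet_J (s : ℕ) (y : ∀ k, Γ k) : MeasurableSet (J s y) := by
  have eq_iInter : J s y = ⋂ i ∈ Finset.range s, (fun x => x i) ⁻¹' {z | IsConj (y i) z} := by
    ext x
    simp [J]
  rw [eq_iInter]
  exact Finset.measurableSet_biInter _ fun i _ =>
    measurable_pi_apply i (Set.toFinite _).measurableSet

theorem haarG_real_J (s : ℕ) (y : ∀ k, Γ k) :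
    (haarG Γ).real (J s y) = ∏ k ∈ Finset.range s, classMass (y k) := by
  have eq_pi : J s y = Set.pi (Finset.range s) fun i => {z | IsConj (y i) z} := by
    ext x
    simp [J, Set.mem_pi]
  rw [eq_pi, measureReal_def, haarG,
    Measure.infinitePi_pi _ fun i _ => (Set.toFinite _).measurableSet, ENNReal.toReal_prod]
  rfl

open scoped Classical in
theorem prod_classMass_inv (s : ℕ) (x y : ∀ k, Γ k) :
    ∏ k ∈ Finset.range s, (if IsConj (y k) (x k) then ((classMass (y k) : ℝ) : ℂ)⁻¹ else 0) =
      if x ∈ J s y then (((haarG Γ).real (J s y) : ℝ) : ℂ)⁻¹ else 0 := by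
  split_ifs with hx
  · rw [haarG_real_J, Complex.ofReal_prod, ← Finset.prod_inv_distrib]
    exact Finset.prod_congr rfl fun k hk => if_pos (hx k (Finset.mem_range.1 hk))
  · obtain ⟨k, hk, not_isConj⟩ : ∃ k < s, ¬ IsConj (y k) (x k) := by
      simpa only [J, Set.mem_ofPred_eq, not_forall, exists_prop] using hx
    exact Finset.prod_eq_zero (Finset.mem_range.2 hk) (if_neg not_isConj)

open scoped Classical in
theorem mixedProd_mixedIdx_mul_conj {r : ∀ k, ℕ → Γ k → ℂ} (hr : ∀ k, r k 0 = fun _ => 1)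
    {N s n : ℕ} (hs : s ≤ N) (hn : n < bigP Γ N) (x y : ∀ k, Γ k) :
    let I := Finset.range N
    mixedProd r s (mixedIdx s n (I.restrict y)) (I.restrict y) *
        conj (mixedProd r s (mixedIdx s n (I.restrict y)) (I.restrict x)) =
      if x ∈ J s y then (((haarG Γ).real (J s y) : ℝ) : ℂ)⁻¹ *
        (chi r (tail Γ s n) y * conj (chi r (tail Γ s n) x)) else 0 := by
  intro I
  have prod_range : (∏ k ∈ I, if k < s then
      (if IsConj (y k) (x k) then ((classMass (y k) : ℝ) : ℂ)⁻¹ else 0) else 1) =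
      if x ∈ J s y then (((haarG Γ).real (J s y) : ℝ) : ℂ)⁻¹ else 0 := by
    rw [← prod_classMass_inv, ← Finset.prod_filter]
    refine Finset.prod_congr (Finset.ext fun k => ?_) fun _ _ => rfl
    simp only [I, Finset.mem_filter, Finset.mem_range]
    lia
  rw [← zero_mul (chi r (tail Γ s n) y * conj (chi r (tail Γ s n) x)), ← ite_mul, ← prod_range,
    chi_tail hr s hn, chi_tail hr s hn, map_prod, mixedProd, mixedProd, map_prod]
  simp only [I, ← Finset.prod_mul_distrib]
  rw [← Finset.prod_coe_sort (Finset.range N)]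
  refine Finset.prod_congr rfl fun k _ => ?_
  by_cases h : (k : ℕ) < s
  · have idx_eq : mixedIdx s n ((Finset.range N).restrict y) k = classIdx (y k) := if_pos h
    simp only [mixedFn, idx_eq, if_pos h, map_one, mul_one]
    exact classFn_classIdx_mul_conj (x k) (y k)
  · have idx_eq : (mixedIdx s n ((Finset.range N).restrict y) k : ℕ) = dig Γ n k :=
      congrArg Fin.val (if_neg h)
    simp only [mixedFn, idx_eq, if_neg h, one_mul, Finset.restrict]

theorem avg_eq_mixedProd_smul_integral {E : Type*} [NormedAddCommGroup E] [NormedSpace ℂ E]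
    {r : ∀ k, ℕ → Γ k → ℂ} (hr : ∀ k, r k 0 = fun _ => 1) {N s n : ℕ} (hs : s ≤ N)
    (hn : n < bigP Γ N) (f : (∀ k, Γ k) → E) (y : ∀ k, Γ k) :
    let I := Finset.range N
    avg r s n f y = mixedProd r s (mixedIdx s n (I.restrict y)) (I.restrict y) •
      ∫ x, conj (mixedProd r s (mixedIdx s n (I.restrict y)) (I.restrict x)) • f x ∂(haarG Γ) := by
  intro I
  rw [avg, ← integral_indicator (measurableSet_J s y), ← integral_smul, ← integral_smul]
  congr 1
  ext x
  rw [smul_smul, mixedProd_mixedIdx_mul_conj hr hs hn]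
  by_cases hx : x ∈ J s y
  · rw [Set.indicator_of_mem hx, if_pos hx, smul_smul]
  · rw [Set.indicator_of_notMem hx, if_neg hx, smul_zero, zero_smul]

end Averages

/-! ### The maximal inequality -/

theorem lemma4p4_general
    {H : Type*} [NormedAddCommGroup H] [InnerProductSpace ℂ H] [CompleteSpace H]
    (M : VonNeumannAlgebra H) (τ : NSFTrace M)
    (Γ : ℕ → Type*) [∀ k, Group (Γ k)] [∀ k, Finite (Γ k)]
    [∀ k, MeasurableSpace (Γ k)] [∀ k, MeasurableSingletonClass (Γ k)]
    (r : ∀ k, ℕ → Γ k → ℂ) (hr : IsCharacterSystem Γ r)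
    (N s : ℕ) {ι : Type*} (n : ι → ℕ) (hn : ∀ i, n i < bigP Γ N) (f : L2N τ (haarG Γ)) :
    ∃ h : ∀ i, MemLp (avg r s (n i) f) 2 (haarG Γ),
      maxNorm τ (haarG Γ) (fun i => (h i).toLp (avg r s (n i) f)) ≤ ‖f‖ₑ := by
  let I := Finset.range (max N s)
  let v (m : ∀ k : I, Fin (numClasses Γ k)) : τ.L2 :=
    ∫ x, conj (mixedProd r s m (I.restrict x)) • f x ∂(haarG Γ)
  have measurable_restrict : Measurable (I.restrict : (∀ k, Γ k) → ∀ k : I, Γ k) :=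
    Finset.measurable_restrict I
  have avg_eq (i : ι) (y : ∀ k, Γ k) : avg r s (n i) f y =
      mixedProd r s (mixedIdx s (n i) (I.restrict y)) (I.restrict y) •
        v (mixedIdx s (n i) (I.restrict y)) :=
    avg_eq_mixedProd_smul_integral (fun k => (hr k).2) (le_max_right N s)
      ((hn i).trans_le (bigP_mono Γ (le_max_left N s))) f y
  have memLp_avg (i : ι) : MemLp (avg r s (n i) f) 2 (haarG Γ) := by
    rw [funext (avg_eq i)]
    exact memLp_comp_of_finite measurable_restrict
      (fun q => mixedProd r s (mixedIdx s (n i) q) q • v (mixedIdx s (n i) q)) 2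
  refine ⟨memLp_avg, (ENNReal.pow_le_pow_left_iff two_ne_zero).1 ?_⟩
  calc maxNorm τ (haarG Γ) (fun i => (memLp_avg i).toLp (avg r s (n i) f)) ^ 2
      ≤ ∫⁻ y, ∑ m, ‖mixedProd r s m (I.restrict y) • v m‖ₑ ^ 2 ∂(haarG Γ) :=
        maxNorm_sq_le_lintegral_square_function (δ := fun i => mixedIdx s (n i))
          (X := fun m q => mixedProd r s m q • v m) measurable_restrict fun i =>
          (memLp_avg i).coeFn_toLp.trans (.of_forall (avg_eq i))
    _ ≤ ‖f‖ₑ ^ 2 :=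
        let _ := τ.innerL2
        lintegral_sum_enorm_smul_integral_sq_le
          (fun m => memLp_comp_of_finite measurable_restrict (mixedProd r s m) 2)
          (integral_mixedProd_mul_conj hr s) f

theorem lemma4p4
    {H : Type*} [NormedAddCommGroup H] [InnerProductSpace ℂ H] [CompleteSpace H]
    (M : VonNeumannAlgebra H) (τ : NSFTrace M)
    (Γ : ℕ → Type*) [∀ k, Group (Γ k)] [∀ k, Finite (Γ k)] [∀ k, Nontrivial (Γ k)]
    [∀ k, MeasurableSpace (Γ k)] [∀ k, MeasurableSingletonClass (Γ k)]
    (r : ∀ k, ℕ → Γ k → ℂ) (hr : IsCharacterSystem Γ r)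
    (A s : ℕ) (hs : s ≤ A) (f : L2N τ (haarG Γ)) :
    ∃ h : ∀ n : block Γ A, MemLp (avg r s n f) 2 (haarG Γ),
      maxNorm τ (haarG Γ) (fun n : block Γ A => (h n).toLp (avg r s n f)) ≤ ‖f‖ₑ :=
  lemma4p4_general M τ Γ r hr (A + 1) s Subtype.val (fun n => lt_bigP_of_mem_block Γ n.2) f
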